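/- Let $V$ be a finite-dimensional Euclidean space and $(W,S)$ a finite Coxeter system, where $m_{st}$ is the order of $st$. Let $(\alpha_s)_{s\in S}$ be a basis of $V$ (the simple roots) such that the numbers $a_{st}=2\langle\alpha_s,\alpha_t\rangle/\langle\alpha_s,\alpha_s\rangle$ form a generalized Cartan matrix for $(W,S)$, i.e. $a_{st}\le 0$ for $s\neq t$ and $a_{st}a_{ts}=4\cos^2(\pi/m_{st})$ for all $s,t \in S$; let $W$ act on $V$ so that each $s\in S$ is the orthogonal reflection in $\alpha_s^\perp$. Let $(\omega_s)_{s\in S}$ be the fundamental weights, determined by $\langle\alpha_s,\omega_t\rangle=\delta_{s=t}\langle\alpha_s,\alpha_s\rangle/2$. Let $w_\circ$ be the longest element of $W$ and let $Q=q_1\cdots q_m$ be a word in $S$ whose Demazure product is $w_\circ$. The subword complex $SC(Q)$ is the simplicial complex of those sets of positions $I\subseteq[m]$ whose complement contains (the positions of) a reduced expression of $w_\circ$. For a facet $I$ of $SC(Q)$ and $k\in[m]$, let $\sigma_I^{[1,k-1]}$ be the product, in increasing order of $z$, of the letters $q_z$ with $z<k$, $z\notin I$, and put $$r(I,k)=\sigma_I^{[1,k-1]}(\alpha_{q_k}),\qquad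 w(I,k)=\sigma_I^{[1,k-1]}(\omega_{q_k}),\qquad B(I)=\sum_{k\in[m]}w(I,k).$$ Let the brick polytope $B(Q)$ be the convex hull of the brick vectors $B(J)$, $J$ a facet of $SC(Q)$. Assume that $Q$ is realizing, i.e. that for every facet $J$ of $SC(Q)$ the root configuration $\{r(J,j) : j\in J\}$ (as a multiset) is a linear basis of $V$. Then for every facet $I$ of $SC(Q)$, the cone of $B(Q)$ at $B(I)$, i.e. the cone generated by $\{x-B(I) : x\in B(Q)\}$, satisfies $$\operatorname{cone}\{x-B(I) : x\in B(Q)\}=\operatorname{cone}\{B(J)-B(I) : J \text{ facet of } SC(Q)\}=\operatorname{cone}\{-r(I,i) : i\in I\},$$ where $\operatorname{cone}(X)$ is the set of all finite non-negative linear combinations of elements of $X$. -/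

import Mathlib

open scoped RealInnerProductSpace

noncomputable section

namespace BrickPolytope

/-! ### Simple roots, the reflection representation and fundamental weights -/

/-- Simple roots for a Coxeter matrix `M` in a Euclidean space `V`: a basis `(α s)` of `V` such that
the numbers `a s t = 2 ⟪α s, α t⟫ / ⟪α s, α s⟫` form a generalized Cartan matrix for `M`, that is
`a s t ≤ 0` for `s ≠ t` and `a s t * a t s = 4 cos² (π / M s t)`.  The two remaining conditions,
`a s s = 2` and `a s t = 0 ↔ a t s = 0`, hold automatically for this formula.  The lengths of the
simple roots are otherwise arbitrary. -/
structure SimpleRoots {S : Type*} (M : CoxeterMatrix S)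
    (V : Type*) [NormedAddCommGroup V] [InnerProductSpace ℝ V] where
  /-- The basis of simple roots. -/
  basis : Module.Basis S ℝ V
  cartan_nonpos : ∀ s t, s ≠ t → 2 * ⟪basis s, basis t⟫ / ⟪basis s, basis s⟫ ≤ 0
  cartan_mul_cartan : ∀ s t,
    (2 * ⟪basis s, basis t⟫ / ⟪basis s, basis s⟫) *
      (2 * ⟪basis t, basis s⟫ / ⟪basis t, basis t⟫) = 4 * Real.cos (Real.pi / M s t) ^ 2

section RootData

variable {S : Type*} {M : CoxeterMatrix S}
variable {V : Type*} [NormedAddCommGroup V] [InnerProductSpace ℝ V]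

/-- The orthogonal reflection of `V` in the hyperplane orthogonal to the simple root `α s`. -/
def SimpleRoots.reflection (D : SimpleRoots M V) (s : S) : V ≃ₗᵢ[ℝ] V :=
  (Submodule.span ℝ {D.basis s})ᗮ.reflection

lemma SimpleRoots.reflection_apply (D : SimpleRoots M V) (s : S) (v : V) :
    D.reflection s v = v - (2 * ⟪D.basis s, v⟫ / ⟪D.basis s, D.basis s⟫) • D.basis s := by
  have h := Submodule.reflection_singleton_apply (𝕜 := ℝ) (D.basis s) v
  rw [SimpleRoots.reflection, Submodule.reflection_orthogonal_apply, h,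
    real_inner_self_eq_norm_sq]
  simp only [RCLike.ofReal_real_eq_id, id_eq]
  rw [mul_div_assoc, mul_smul, two_smul, two_smul]
  abel

open Polynomial.Chebyshev in
/-- The reflections in the simple roots satisfy the relations of the Coxeter group of `M`. -/
lemma SimpleRoots.isLiftable (D : SimpleRoots M V) : M.IsLiftable D.reflection := by
  intro s t
  have hpos : ∀ u, ⟪D.basis u, D.basis u⟫ ≠ 0 := fun u =>
    inner_self_ne_zero.mpr (D.basis.ne_zero u)
  by_cases hst : s = t
  · subst hst
    rw [M.diagonal, pow_one]
    exact Submodule.reflection_mul_reflection _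
  obtain ⟨f, hfdef⟩ : ∃ f : S → Module.Dual ℝ V, ∀ u v,
      f u v = 2 * ⟪D.basis u, v⟫ / ⟪D.basis u, D.basis u⟫ :=
    ⟨fun u => (2 / ⟪D.basis u, D.basis u⟫) • innerₗ V (D.basis u), fun u v => by
      simp only [LinearMap.smul_apply, innerₗ_apply_apply, smul_eq_mul]
      ring⟩
  have hf : ∀ u, f u (D.basis u) = 2 := fun u => by
    rw [hfdef, mul_div_assoc, div_self (hpos u), mul_one]
  have hpow : ∀ (n : ℕ) (v : V), ((D.reflection s * D.reflection t) ^ n) v =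
      ((Module.reflection (hf s) * Module.reflection (hf t)) ^ n) v := by
    intro n
    induction n with
    | zero => intro v; simp
    | succ n ih =>
      intro v
      rw [pow_succ, pow_succ, LinearIsometryEquiv.coe_mul, Function.comp_apply, ih,
        LinearEquiv.mul_apply]
      congr 1
      rw [LinearIsometryEquiv.coe_mul, Function.comp_apply, LinearEquiv.mul_apply,
        SimpleRoots.reflection_apply, SimpleRoots.reflection_apply, Module.reflection_apply,
        Module.reflection_apply, hfdef, hfdef]
  have hprod : f s (D.basis t) * f t (D.basis s) = 4 * Real.cos (Real.pi / M s t) ^ 2 := by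
    rw [hfdef, hfdef]
    exact D.cartan_mul_cartan s t
  have hzero : f s (D.basis t) = 0 ↔ f t (D.basis s) = 0 := by
    rw [hfdef, hfdef]
    simp only [div_eq_zero_iff, mul_eq_zero, hpos, real_inner_comm, OfNat.ofNat_ne_zero, false_or,
      or_false]
  ext v
  rw [hpow]
  change _ = v
  obtain h0 | h0 := Nat.eq_zero_or_pos (M s t)
  · rw [h0]; simp
  have h1 : M s t ≠ 1 := M.off_diagonal s t hst
  obtain h2 | h2 := eq_or_ne (M s t) 2
  · have hc : f s (D.basis t) * f t (D.basis s) = 0 := by rw [hprod, h2]; simp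
    have ha : f s (D.basis t) = 0 := by
      rcases mul_eq_zero.mp hc with h | h
      · exact h
      · exact hzero.mpr h
    have hb := hzero.mp ha
    rw [h2, Module.reflection_mul_reflection_pow_apply]
    simp only [ha, hb]
    norm_num
    abel
  have h3 : 3 ≤ M s t := by omega
  set θ : ℝ := 2 * Real.pi / M s t with hθ
  have hM : (0 : ℝ) < M s t := by exact_mod_cast h0
  have hMθ : (M s t : ℝ) * θ = 2 * Real.pi := by rw [hθ]; field_simp
  have hsin : Real.sin θ ≠ 0 := by
    refine (Real.sin_pos_of_pos_of_lt_pi (by positivity) ?_).ne'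
    rw [hθ, div_lt_iff₀ hM]
    have : (3 : ℝ) ≤ M s t := by exact_mod_cast h3
    nlinarith [Real.pi_pos]
  have ht : 2 * Real.cos θ = f s (D.basis t) * f t (D.basis s) - 2 := by
    rw [hprod, hθ, show 2 * Real.pi / (M s t : ℝ) = 2 * (Real.pi / M s t) by ring, Real.cos_two_mul]
    ring
  rw [Module.reflection_mul_reflection_pow_apply (hf s) (hf t) (M s t) v (2 * Real.cos θ) ht]
  obtain ⟨k, hk | hk⟩ := Nat.even_or_odd' (M s t)
  · have hS : (Polynomial.Chebyshev.S ℝ ((k : ℤ) - 1)).eval (2 * Real.cos θ) = 0 := by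
      have h := S_two_mul_real_cos θ ((k : ℤ) - 1)
      have hkθ : (k : ℝ) * θ = Real.pi := by
        rw [hk] at hMθ
        push_cast at hMθ
        linarith
      push_cast at h
      rw [sub_add_cancel, hkθ, Real.sin_pi] at h
      exact (mul_eq_zero.mp h).resolve_right hsin
    have e1 : ((M s t : ℤ) - 2) / 2 = (k : ℤ) - 1 := by omega
    have e2 : ((M s t : ℤ) - 1) / 2 = (k : ℤ) - 1 := by omega
    rw [e1, e2, hS]
    simp
  · have hS : (Polynomial.Chebyshev.S ℝ (k : ℤ)).eval (2 * Real.cos θ) +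
        (Polynomial.Chebyshev.S ℝ ((k : ℤ) - 1)).eval (2 * Real.cos θ) = 0 := by
      have h := S_two_mul_real_cos θ (k : ℤ)
      have h' := S_two_mul_real_cos θ ((k : ℤ) - 1)
      have hkθ : (k : ℝ) * θ = 2 * Real.pi - ((k : ℝ) + 1) * θ := by
        rw [hk] at hMθ
        push_cast at hMθ
        linarith
      push_cast at h h'
      rw [sub_add_cancel, hkθ, Real.sin_two_pi_sub] at h'
      refine (mul_eq_zero.mp (?_ : _ * Real.sin θ = 0)).resolve_right hsin
      rw [add_mul, h, h']
      ring
    have e1 : ((M s t : ℤ) - 3) / 2 = (k : ℤ) - 1 := by omega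
    have e2 : ((M s t : ℤ) - 1) / 2 = (k : ℤ) := by omega
    have e3 : ((M s t : ℤ) - 2) / 2 = (k : ℤ) - 1 := by omega
    have e4 : (M s t : ℤ) / 2 = (k : ℤ) := by omega
    rw [e1, e2, e3, e4, hS]
    simp

/-- The action of the Coxeter group `W` on `V`, in which each simple reflection `s` acts as the
orthogonal reflection in the hyperplane orthogonal to the simple root `α s`. -/
def SimpleRoots.action (D : SimpleRoots M V) {W : Type*} [Group W] (cs : CoxeterSystem M W) :
    W →* (V ≃ₗᵢ[ℝ] V) :=
  cs.lift ⟨D.reflection, D.isLiftable⟩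

/-- The renormalized root basis `2 α s / ⟪α s, α s⟫`. -/
def SimpleRoots.renormalizedBasis (D : SimpleRoots M V) : Module.Basis S ℝ V :=
  D.basis.isUnitSMul (w := fun s => 2 / ⟪D.basis s, D.basis s⟫) fun s =>
    (div_ne_zero two_ne_zero (inner_self_ne_zero.mpr (D.basis.ne_zero s))).isUnit

variable (V) in
lemma inner_nondegenerate : LinearMap.BilinForm.Nondegenerate (innerₗ V) :=
  ⟨fun x h => inner_self_eq_zero.mp (h x), fun x h => inner_self_eq_zero.mp (h x)⟩

open Classical in
/-- The fundamental weights: the basis dual to the renormalized root basis with respect to the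
inner product, so that `⟪α s, ω t⟫ = ⟪α s, α s⟫ / 2` if `s = t` and `0` otherwise. -/
def SimpleRoots.weight [Finite S] (D : SimpleRoots M V) : Module.Basis S ℝ V :=
  LinearMap.BilinForm.dualBasis (innerₗ V) (inner_nondegenerate V) D.renormalizedBasis

open Classical in
lemma SimpleRoots.inner_basis_weight [Finite S] (D : SimpleRoots M V) (s t : S) :
    ⟪D.basis s, D.weight t⟫ = if s = t then ⟪D.basis s, D.basis s⟫ / 2 else 0 := by
  have h : ⟪D.weight t, D.renormalizedBasis s⟫ = if s = t then 1 else 0 :=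
    LinearMap.BilinForm.apply_dualBasis_left (inner_nondegenerate V) D.renormalizedBasis t s
  have hp : ⟪D.basis s, D.basis s⟫ ≠ 0 := inner_self_ne_zero.mpr (D.basis.ne_zero s)
  rw [SimpleRoots.renormalizedBasis, Module.Basis.isUnitSMul_apply, inner_smul_right,
    real_inner_comm (D.basis s) (D.weight t)] at h
  split_ifs at h ⊢
  · field_simp at h
    linarith
  · exact (mul_eq_zero.mp h).resolve_left (div_ne_zero two_ne_zero hp)

end RootData

/-! ### Words and subword complexes -/

section Words

variable {S : Type*} {M : CoxeterMatrix S} {W : Type*} [Group W] (cs : CoxeterSystem M W)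

/-- An element of maximal length in the finite Coxeter group `W` (it is unique). -/
def longestElement [Finite W] : W := (Finite.exists_max cs.length).choose

/-- One step of the Demazure product: `w ↦ w s` if this increases the length, `w ↦ w` otherwise. -/
def demazureStep (w : W) (s : S) : W :=
  if cs.length (w * cs.simple s) = cs.length w + 1 then w * cs.simple s else w

/-- The Demazure product of a word `q₁ ⋯ qₘ`. -/
def demazureProduct {m : ℕ} (Q : Fin m → S) : W :=
  (List.ofFn Q).foldl (demazureStep cs) 1

/-- The subword of `Q` formed by the letters at the positions in `A`, read from left to right. -/
def subword {m : ℕ} (Q : Fin m → S) (A : Finset (Fin m)) : List S :=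
  ((List.finRange m).filter (· ∈ A)).map Q

/-- The subword complex `SC(Q, ρ)`: the sets of positions whose complement contains a reduced
expression of `ρ`. -/
def subwordComplex {m : ℕ} (Q : Fin m → S) (ρ : W) : Set (Finset (Fin m)) :=
  {I | ∃ A : Finset (Fin m), A ⊆ Iᶜ ∧ cs.IsReduced (subword Q A) ∧ cs.wordProd (subword Q A) = ρ}

/-- The facets (inclusion-maximal faces) of the subword complex `SC(Q) = SC(Q, w₀)`, where `w₀` is
the longest element of `W`. -/
def IsFacet [Finite W] {m : ℕ} (Q : Fin m → S) (I : Finset (Fin m)) : Prop :=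
  Maximal (· ∈ subwordComplex cs Q (longestElement cs)) I

end Words

/-! ### Root configurations and brick polytopes -/

section Brick

variable {S : Type*} {M : CoxeterMatrix S} {W : Type*} [Group W] (cs : CoxeterSystem M W)
variable {V : Type*} [NormedAddCommGroup V] [InnerProductSpace ℝ V] (D : SimpleRoots M V)
variable {m : ℕ} (Q : Fin m → S)

/-- The product in `W` of the letters `q_z`, for the positions `z < k` with `z ∉ I`, in this
order. -/
def prefixProd (I : Finset (Fin m)) (k : Fin m) : W :=
  cs.wordProd (subword Q (Finset.Iio k \ I))

/-- The root function `r(I, k)`. -/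
def rootFunction (I : Finset (Fin m)) (k : Fin m) : V :=
  D.action cs (prefixProd cs Q I k) (D.basis (Q k))

/-- The weight function `w(I, k)`. -/
def weightFunction [Finite S] (I : Finset (Fin m)) (k : Fin m) : V :=
  D.action cs (prefixProd cs Q I k) (D.weight (Q k))

/-- The root configuration of `I`: the family (multiset) of the roots `r(I, i)` for `i ∈ I`. -/
def rootConfiguration (I : Finset (Fin m)) : I → V := fun i => rootFunction cs D Q I i

/-- The brick vector of `I`. -/
def brickVector [Finite S] (I : Finset (Fin m)) : V := ∑ k, weightFunction cs D Q I k

/-- The brick polytope of `Q`. -/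
def brickPolytope [Finite S] [Finite W] : Set V :=
  convexHull ℝ {x | ∃ I, IsFacet cs Q I ∧ x = brickVector cs D Q I}

/-- The word `Q` is realizing: its Demazure product is the longest element and the root
configuration of every facet of `SC(Q)` is a linear basis of `V`. -/
structure IsRealizing [Finite W] : Prop where
  demazureProduct_eq : demazureProduct cs Q = longestElement cs
  linearIndependent : ∀ I, IsFacet cs Q I → LinearIndependent ℝ (rootConfiguration cs D Q I)
  span_eq_top : ∀ I, IsFacet cs Q I →
    Submodule.span ℝ (Set.range (rootConfiguration cs D Q I)) = ⊤

end Brick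

/-- The cone of a polytope `P` at a point `v` of `P`: the cone generated by `x - v` for `x ∈ P`. -/
def coneAt {V : Type*} [AddCommGroup V] [Module ℝ V] (P : Set V) (v : V) : PointedCone ℝ V :=
  PointedCone.hull ℝ {y | ∃ x ∈ P, y = x - v}

end BrickPolytope

end

/-! The brick vectors are compared through flips. Write `P n` for the product of the letters outside
`I` among the first `n` positions. For `i ∈ I` with root `γ = r(I,i)`, the sign of `(P n)⁻¹ γ` must
change at some position `j ∉ I` whose root lies on the line of `γ`. Exchanging `i` for `j` gives a
facet `J`. It applies the reflection in `γ` to exactly the weights located between the two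
positions, and these weights pair non-negatively with `γ`, so `B(J) = B(I) - c γ` with `c > 0`
(`IsFacet.exists_flip`). Hence every `-r(I,i)` lies in the cone of the differences.

For the reverse inclusion, a functional `f` that is positive on the root configuration of `I` must
be maximal at `B(I)` among all brick vectors (`IsRealizing.inner_brickVector_le`). Choose `w` such
that `f` lies in the closed chamber of `w`. Then `I` is `w`-good: its roots lie in the `w`-image of
the positive roots. A facet that is not `w`-good has a flip that does not decrease `f` and strictly
increases a generic functional of that chamber, so from any facet one climbs to a `w`-good one. By
`IsRealizing.eq_of_isGood` the only such facet is `I`; this is an induction on `w`, crossing one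
wall at a time, and it uses the linear independence of the root configurations. Testing with
perturbed dual basis vectors shows that `B(J) - B(I)` has non-positive coordinates in the basis
`r(I,i)`.

Simple roots have arbitrary lengths, so a line may contain several positive roots. Roots are
therefore compared only up to positive scalars. -/

noncomputable section

namespace BrickPolytope

/-! ### Lengths and signs of roots. -/

section Roots

variable {S : Type*} {M : CoxeterMatrix S} {W : Type*} [Group W] (cs : CoxeterSystem M W)
variable {V : Type*} [NormedAddCommGroup V] [InnerProductSpace ℝ V] (D : SimpleRoots M V)

/-- A vector is nonnegative if all its coordinates in the basis of simple roots are. -/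
def SimpleRoots.Nonneg (v : V) : Prop := ∀ s, 0 ≤ D.basis.repr v s

namespace SimpleRoots

variable {D} in
lemma Nonneg.add {v w : V} (hv : D.Nonneg v) (hw : D.Nonneg w) : D.Nonneg (v + w) := fun s => by
  simpa using add_nonneg (hv s) (hw s)

variable {D} in
lemma Nonneg.smul {c : ℝ} (hc : 0 ≤ c) {v : V} (hv : D.Nonneg v) : D.Nonneg (c • v) := fun s => by
  simpa using mul_nonneg hc (hv s)

lemma nonneg_basis (s : S) : D.Nonneg (D.basis s) := fun t => by
  classical
  rw [Module.Basis.repr_self, Finsupp.single_apply]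
  split_ifs <;> norm_num

lemma nonneg_smul_iff {c : ℝ} (hc : 0 < c) {v : V} : D.Nonneg (c • v) ↔ D.Nonneg v := by
  refine ⟨fun h => ?_, .smul hc.le⟩
  have := h.smul (inv_nonneg.mpr hc.le)
  rwa [inv_smul_smul₀ hc.ne'] at this

variable {D} in
lemma Nonneg.eq_zero {v : V} (h : D.Nonneg v) (h' : D.Nonneg (-v)) : v = 0 := by
  apply D.basis.ext_elem
  intro s
  have h1 := h s
  have h2 := h' s
  simp only [map_neg, Finsupp.coe_neg, Pi.neg_apply, map_zero, Finsupp.coe_zero,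
    Pi.zero_apply] at h2 ⊢
  linarith

@[simp] lemma action_simple (s : S) : D.action cs (cs.simple s) = D.reflection s :=
  cs.lift_apply_simple D.isLiftable s

lemma action_mul_apply (w w' : W) (v : V) :
    D.action cs (w * w') v = D.action cs w (D.action cs w' v) := by
  rw [map_mul]; rfl

@[simp] lemma action_inv_action (w : W) (v : V) : D.action cs w⁻¹ (D.action cs w v) = v := by
  rw [← action_mul_apply, inv_mul_cancel, map_one]; rfl

@[simp] lemma action_action_inv (w : W) (v : V) : D.action cs w (D.action cs w⁻¹ v) = v := by
  rw [← action_mul_apply, mul_inv_cancel, map_one]; rfl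

lemma inner_action_left (w : W) (v u : V) :
    ⟪D.action cs w v, u⟫ = ⟪v, D.action cs w⁻¹ u⟫ := by
  conv_lhs => rw [← D.action_action_inv cs w u]
  exact LinearIsometryEquiv.inner_map_map _ _ _

lemma inner_basis_self_pos (s : S) : 0 < ⟪D.basis s, D.basis s⟫ :=
  real_inner_self_pos.mpr (D.basis.ne_zero s)

lemma reflection_basis (s : S) : D.reflection s (D.basis s) = -D.basis s := by
  rw [reflection_apply, mul_div_assoc, div_self (D.inner_basis_self_pos s).ne', mul_one, two_smul]
  abel

lemma reflection_reflection (s : S) (v : V) : D.reflection s (D.reflection s v) = v :=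
  Submodule.reflection_reflection _ v

/-- The unit vector in the direction of a simple root. -/
def unit (s : S) : V := ‖D.basis s‖⁻¹ • D.basis s

lemma norm_basis_pos (s : S) : 0 < ‖D.basis s‖ := norm_pos_iff.mpr (D.basis.ne_zero s)

lemma basis_eq_smul_unit (s : S) : D.basis s = ‖D.basis s‖ • D.unit s := by
  rw [unit, smul_inv_smul₀ (D.norm_basis_pos s).ne']

lemma inner_unit_nonpos {s t : S} (h : s ≠ t) : ⟪D.unit s, D.unit t⟫ ≤ 0 := by
  have h1 := D.cartan_nonpos s t h
  have h2 : ⟪D.basis s, D.basis t⟫ ≤ 0 := by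
    by_contra! hc
    have := div_pos (mul_pos two_pos hc) (D.inner_basis_self_pos s)
    linarith
  rw [unit, unit, real_inner_smul_left, real_inner_smul_right]
  exact mul_nonpos_of_nonneg_of_nonpos (by positivity)
    (mul_nonpos_of_nonneg_of_nonpos (by positivity) h2)

lemma inner_unit_sq (s t : S) : ⟪D.unit s, D.unit t⟫ ^ 2 = Real.cos (Real.pi / M s t) ^ 2 := by
  have h := D.cartan_mul_cartan s t
  have hs := D.norm_basis_pos s
  have ht := D.norm_basis_pos t
  rw [real_inner_self_eq_norm_sq, real_inner_self_eq_norm_sq, real_inner_comm (D.basis s)] at h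
  rw [unit, unit, real_inner_smul_left, real_inner_smul_right]
  field_simp at h ⊢
  linarith

lemma inner_unit {s t : S} (h : s ≠ t) : ⟪D.unit s, D.unit t⟫ = -Real.cos (Real.pi / M s t) := by
  have h1 := D.inner_unit_nonpos h
  have h2 := D.inner_unit_sq s t
  have h3 : 0 ≤ Real.cos (Real.pi / M s t) := by
    -- The entry `0` encodes infinite order; then `π / 0 = 0` and the cosine is `1`.
    have hM : M s t = 0 ∨ 2 ≤ M s t := by have := M.off_diagonal s t h; omega
    rcases hM with hM | hM
    · simp [hM]
    · have : (2 : ℝ) ≤ M s t := by exact_mod_cast hM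
      apply Real.cos_nonneg_of_neg_pi_div_two_le_of_le
      · have : 0 ≤ Real.pi / M s t := by positivity
        linarith [Real.pi_pos]
      · gcongr
  rcases sq_eq_sq_iff_eq_or_eq_neg.mp h2 with h4 | h4 <;> linarith

lemma reflection_unit_self (s : S) : D.reflection s (D.unit s) = -D.unit s := by
  rw [unit, map_smul, reflection_basis, smul_neg]

lemma norm_unit (s : S) : ‖D.unit s‖ = 1 := by
  rw [unit, norm_smul, norm_inv, norm_norm, inv_mul_cancel₀ (D.norm_basis_pos s).ne']

lemma reflection_unit {s t : S} (h : s ≠ t) :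
    D.reflection s (D.unit t) = D.unit t + (2 * Real.cos (Real.pi / M s t)) • D.unit s := by
  have hs := D.norm_basis_pos s
  rw [reflection_apply, sub_eq_add_neg, ← neg_smul]
  congr 1
  rw [D.basis_eq_smul_unit s, real_inner_smul_left, D.inner_unit h, smul_smul,
    real_inner_smul_left, real_inner_smul_right, real_inner_self_eq_norm_sq, D.norm_unit]
  congr 1
  field_simp

/-- Positive definiteness excludes infinite order: two unit vectors with inner product `-1` are
opposite, against linear independence of the simple roots. -/
lemma coxeterMatrix_ne_zero (D : SimpleRoots M V) {s t : S} (h : s ≠ t) : M s t ≠ 0 := by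
  intro h0
  have h1 := D.inner_unit h
  rw [h0] at h1
  simp only [Nat.cast_zero, div_zero, Real.cos_zero] at h1
  have h2 : ‖D.unit s + D.unit t‖ ^ 2 = 0 := by
    rw [norm_add_sq_real, h1, norm_unit, norm_unit]
    norm_num
  have h3 : D.unit s + D.unit t = 0 := norm_eq_zero.mp (pow_eq_zero_iff two_ne_zero |>.mp h2)
  have h4 := congrArg (fun v => D.basis.repr v s) h3
  simp only [unit, map_add, map_smul, Module.Basis.repr_self, Finsupp.coe_add, Finsupp.coe_smul,
    Pi.add_apply, Pi.smul_apply, Finsupp.single_eq_same, Finsupp.single_eq_of_ne h, smul_eq_mul,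
    mul_one, mul_zero, add_zero, map_zero, Finsupp.coe_zero, Pi.zero_apply] at h4
  exact (inv_pos.mpr (D.norm_basis_pos s)).ne' h4

lemma two_le_coxeterMatrix (D : SimpleRoots M V) {s t : S} (h : s ≠ t) : 2 ≤ M s t := by
  have := M.off_diagonal s t h
  have := D.coxeterMatrix_ne_zero h
  omega

/-- The action of alternating words on a simple root, in the plane spanned by two simple roots. -/
lemma sin_smul_action_alternatingWord {s t : S} (h : s ≠ t) (k : ℕ) :
    Real.sin (Real.pi / M s t) •
        D.action cs (cs.wordProd (CoxeterSystem.alternatingWord s t k)) (D.unit s) =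
      if Even k then
        Real.sin ((k + 1) * (Real.pi / M s t)) • D.unit s +
          Real.sin (k * (Real.pi / M s t)) • D.unit t
      else
        Real.sin (k * (Real.pi / M s t)) • D.unit s +
          Real.sin ((k + 1) * (Real.pi / M s t)) • D.unit t := by
  set θ := Real.pi / M s t with hθ
  have hθ' : Real.pi / M t s = θ := by rw [hθ, M.symmetric]
  -- The three-term recursion for sines is exactly the effect of one more reflection on the two
  -- coefficients.
  have hrec : ∀ k : ℕ, 2 * Real.cos θ * Real.sin ((k + 1) * θ) - Real.sin (k * θ) =
      Real.sin ((k + 1 + 1) * θ) := by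
    intro k
    have e1 : ((k : ℝ) + 1 + 1) * θ = (k + 1) * θ + θ := by ring
    have e2 : (k : ℝ) * θ = (k + 1) * θ - θ := by ring
    rw [e1, e2, Real.sin_add, Real.sin_sub]
    ring
  induction k with
  | zero => simp [CoxeterSystem.alternatingWord]
  | succ k ih =>
    rw [CoxeterSystem.alternatingWord_succ', CoxeterSystem.wordProd_cons, action_mul_apply,
      ← map_smul, ih]
    by_cases hk : Even k
    · have hk' : ¬ Even (k + 1) := by simpa [Nat.even_add_one] using hk
      rw [if_pos hk, if_pos hk, if_neg hk', action_simple, map_add, map_smul, map_smul,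
        D.reflection_unit h.symm, D.reflection_unit_self, hθ']
      push_cast
      rw [← hrec k]
      module
    · have hk' : Even (k + 1) := by simpa [Nat.even_add_one] using hk
      rw [if_neg hk, if_neg hk, if_pos hk', action_simple, map_add, map_smul, map_smul,
        D.reflection_unit h, D.reflection_unit_self, ← hθ]
      push_cast
      rw [← hrec k]
      module

/-- For `k < M s t` the angles `kπ/M` and `(k+1)π/M` stay in `[0, π]`, so both sine coefficients are
non-negative. -/
lemma exists_action_alternatingWord {s t : S} (h : s ≠ t) {k : ℕ} (hk : k < M s t) :
    ∃ a b : ℝ, 0 ≤ a ∧ 0 ≤ b ∧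
      D.action cs (cs.wordProd (CoxeterSystem.alternatingWord s t k)) (D.basis s) =
        a • D.basis s + b • D.basis t := by
  have hM : (2 : ℝ) ≤ M s t := by exact_mod_cast D.two_le_coxeterMatrix h
  have hM0 : (0 : ℝ) < M s t := by linarith
  have hsin : 0 < Real.sin (Real.pi / M s t) := by
    refine Real.sin_pos_of_pos_of_lt_pi (by positivity) ?_
    rw [div_lt_iff₀ hM0]
    nlinarith [Real.pi_pos]
  have hnn : ∀ l : ℕ, l ≤ M s t → 0 ≤ Real.sin (l * (Real.pi / M s t)) := by
    intro l hl
    apply Real.sin_nonneg_of_nonneg_of_le_pi (by positivity)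
    have : (l : ℝ) ≤ M s t := by exact_mod_cast hl
    rw [← mul_div_assoc, div_le_iff₀ hM0]
    nlinarith [Real.pi_pos]
  have hu := D.sin_smul_action_alternatingWord cs h k
  have h1 := hnn k hk.le
  have h2 := hnn (k + 1) hk
  push_cast at h2
  have key : ∀ x y : ℝ, 0 ≤ x → 0 ≤ y → Real.sin (Real.pi / M s t) •
        D.action cs (cs.wordProd (CoxeterSystem.alternatingWord s t k)) (D.unit s) =
      x • D.unit s + y • D.unit t → ∃ a b : ℝ, 0 ≤ a ∧ 0 ≤ b ∧
      D.action cs (cs.wordProd (CoxeterSystem.alternatingWord s t k)) (D.basis s) =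
        a • D.basis s + b • D.basis t := by
    intro x y hx hy hxy
    have hs := D.norm_basis_pos s
    have ht := D.norm_basis_pos t
    refine ⟨x / Real.sin (Real.pi / M s t), ‖D.basis s‖ * y / Real.sin (Real.pi / M s t) /
      ‖D.basis t‖, by positivity, by positivity, ?_⟩
    apply smul_right_injective V hsin.ne'
    beta_reduce
    nth_rw 1 [D.basis_eq_smul_unit s]
    rw [map_smul, smul_comm, hxy, unit, unit, smul_add, smul_add, smul_smul, smul_smul, smul_smul,
      smul_smul, smul_smul, smul_smul]
    congr 2 <;> field_simp
  split_ifs at hu with hev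
  · exact key _ _ h2 h1 hu
  · exact key _ _ h1 h2 hu

/-- If `w s` is longer than `w` then `w` maps the simple root of `s` to a nonnegative vector. -/
theorem nonneg_action_basis {w : W} {s : S} (h : cs.length w < cs.length (w * cs.simple s)) :
    D.Nonneg (D.action cs w (D.basis s)) := by
  induction hn : cs.length w using Nat.strong_induction_on generalizing w s with
  | _ n ih =>
  subst hn
  by_cases hw : w = 1
  · rw [hw, map_one]
    exact D.nonneg_basis s
  obtain ⟨t, ht⟩ := cs.exists_rightDescent_of_ne_one hw
  have ht' := cs.isRightDescent_iff.mp ht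
  have hst : s ≠ t := by
    rintro rfl
    unfold CoxeterSystem.IsRightDescent at ht
    omega
  let aw := fun k => cs.wordProd (CoxeterSystem.alternatingWord s t k)
  -- `p k` says that the alternating word of length `k` ending in `t` can be split off `w` on the
  -- right with lengths adding. The largest such `k` leaves a factor `v` with no descent at `s` or
  -- `t`, to which induction applies.
  let p := fun k => cs.length (w * (aw k)⁻¹) + k = cs.length w
  have hp1 : p 1 := by simpa [p, aw, CoxeterSystem.alternatingWord] using ht'
  have hple : ∀ k, p k → k ≤ cs.length w := fun k hk => by simp only [p] at hk; omega
  classical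
  set k := Nat.findGreatest p (cs.length w)
  have hk : p k := Nat.findGreatest_spec (hple 1 hp1) hp1
  have hk1 : 1 ≤ k := Nat.le_findGreatest (hple 1 hp1) hp1
  have hkmax : ∀ l, p l → l ≤ k := fun l hl => Nat.le_findGreatest (hple l hl) hl
  set v := w * (aw k)⁻¹ with hv
  have hwv : w = v * aw k := by rw [hv]; group
  have hlen : cs.length v + k = cs.length w := hk
  have hawle : ∀ (a b : S) (l : ℕ),
      cs.length (cs.wordProd (CoxeterSystem.alternatingWord a b l)) ≤ l := fun a b l => by
    simpa using cs.length_wordProd_le (CoxeterSystem.alternatingWord a b l)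
  have hkM : k < M s t := by
    by_contra! hle
    have hM := D.two_le_coxeterMatrix hst
    have hdown : ∀ l, p (l + 1) → p l := by
      intro l hl
      have h1 : w * (aw l)⁻¹ =
          w * (aw (l + 1))⁻¹ * cs.simple (if Even l then t else s) := by
        simp only [aw]
        rw [CoxeterSystem.alternatingWord_succ', CoxeterSystem.wordProd_cons]
        simp [mul_assoc]
      have h2 := cs.length_mul_le (w * (aw (l + 1))⁻¹) (cs.simple (if Even l then t else s))
      have h3 := cs.length_mul_le (w * (aw l)⁻¹) (aw l)
      have h4 := hawle s t l
      rw [← h1, cs.length_simple] at h2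
      rw [inv_mul_cancel_right] at h3
      simp only [p, aw] at hl h2 h3 ⊢
      omega
    have hpM : p (M s t) := Nat.decreasingInduction (motive := fun l _ => p l)
      (fun l _ hl => hdown l hl) hk hle
    -- By the braid relation the word of length `M s t` can also be made to end in `s`. If it split
    -- off `w`, then `w s` would be shorter than `w`.
    have hbraid : aw (M s t) * cs.simple s =
        cs.wordProd (CoxeterSystem.alternatingWord s t (M s t - 1)) := by
      have h1 := cs.wordProd_braidWord_eq s t
      unfold CoxeterSystem.braidWord at h1
      obtain ⟨l, hl⟩ : ∃ l, M s t = l + 1 := ⟨M s t - 1, by omega⟩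
      rw [M.symmetric t s, hl, CoxeterSystem.alternatingWord_succ t s, cs.wordProd_concat] at h1
      simp only [aw]
      rw [hl, h1, cs.simple_mul_simple_cancel_right, Nat.add_sub_cancel]
    have h1 : w * cs.simple s = w * (aw (M s t))⁻¹ *
        cs.wordProd (CoxeterSystem.alternatingWord s t (M s t - 1)) := by
      rw [← hbraid]
      group
    have h2 := cs.length_mul_le (w * (aw (M s t))⁻¹)
      (cs.wordProd (CoxeterSystem.alternatingWord s t (M s t - 1)))
    rw [← h1] at h2
    have h3 := hawle s t (M s t - 1)
    simp only [p] at hpM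
    omega
  obtain ⟨a, b, ha, hb, hab⟩ := D.exists_action_alternatingWord cs hst hkM
  have hlead : ∀ x : S, (x = s ∨ x = t) → cs.length v < cs.length (v * cs.simple x) := by
    intro x hx
    by_contra! hle
    have hlt : cs.length (v * cs.simple x) + 1 = cs.length v := by
      rcases cs.length_mul_simple v x with h | h <;> omega
    -- Either `x` is the letter that would extend the alternating word, against maximality of `k`,
    -- or it is the first letter of that word, and then cancelling it writes `w` with too few
    -- letters.
    by_cases hxk : x = if Even k then t else s
    · have hpk : p (k + 1) := by
        have : w * (aw (k + 1))⁻¹ = v * cs.simple x := by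
          simp only [aw, hv]
          rw [CoxeterSystem.alternatingWord_succ', CoxeterSystem.wordProd_cons, ← hxk]
          simp [mul_assoc]
        simp only [p]
        rw [this]
        omega
      have := hkmax _ hpk
      omega
    · obtain ⟨l, hl⟩ : ∃ l, k = l + 1 := ⟨k - 1, by omega⟩
      have hxl : x = if Even l then t else s := by
        have hev := Nat.even_add_one (n := l)
        rw [← hl] at hev
        split_ifs at hxk ⊢ <;> tauto
      have hwx : w = v * cs.simple x * cs.wordProd (CoxeterSystem.alternatingWord s t l) := by
        have : aw k = cs.simple x * cs.wordProd (CoxeterSystem.alternatingWord s t l) := by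
          simp only [aw]
          rw [hl, CoxeterSystem.alternatingWord_succ', CoxeterSystem.wordProd_cons, ← hxl]
        rw [mul_assoc, ← this, hwv]
      have h1 := cs.length_mul_le (v * cs.simple x)
        (cs.wordProd (CoxeterSystem.alternatingWord s t l))
      rw [← hwx] at h1
      have := hawle s t l
      omega
  have hvlt : cs.length v < cs.length w := by omega
  rw [hwv, action_mul_apply, hab, map_add, map_smul, map_smul]
  exact ((ih _ hvlt (hlead s (.inl rfl)) rfl).smul ha).add
    ((ih _ hvlt (hlead t (.inr rfl)) rfl).smul hb)

end SimpleRoots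

end Roots

/-! ### Positive and negative roots, the longest element, and pairing with weights. -/

section RootSigns

variable {S : Type*} {M : CoxeterMatrix S} {W : Type*} [Group W] (cs : CoxeterSystem M W)
variable {V : Type*} [NormedAddCommGroup V] [InnerProductSpace ℝ V] (D : SimpleRoots M V)

/-- The reflection orthogonal to a vector `γ`. -/
def reflectionIn (γ v : V) : V := v - (2 * ⟪γ, v⟫ / ⟪γ, γ⟫) • γ

lemma reflectionIn_smul {c : ℝ} (hc : c ≠ 0) (γ v : V) :
    reflectionIn (c • γ) v = reflectionIn γ v := by
  rw [reflectionIn, reflectionIn, real_inner_smul_left, real_inner_smul_left,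
    real_inner_smul_right, smul_smul]
  congr 2
  field_simp

lemma reflectionIn_self {γ : V} (hγ : γ ≠ 0) : reflectionIn γ γ = -γ := by
  rw [reflectionIn, mul_div_assoc, div_self (inner_self_ne_zero.mpr hγ), mul_one, two_smul]
  abel

lemma map_reflectionIn (f : V ≃ₗᵢ[ℝ] V) (γ v : V) :
    f (reflectionIn γ v) = reflectionIn (f γ) (f v) := by
  simp [reflectionIn]

namespace SimpleRoots

lemma reflectionIn_basis (s : S) (v : V) : reflectionIn (D.basis s) v = D.reflection s v :=
  (D.reflection_apply s v).symm

/-- A conjugate of a simple reflection acts as the reflection in the corresponding root. -/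
lemma action_conj (x : W) (s : S) (v : V) :
    D.action cs (x * cs.simple s * x⁻¹) v = reflectionIn (D.action cs x (D.basis s)) v := by
  rw [action_mul_apply, action_mul_apply, action_simple, ← reflectionIn_basis, map_reflectionIn,
    action_action_inv]

/-- The roots: the images of the simple roots under the group. -/
def IsRoot (v : V) : Prop := ∃ x s, v = D.action cs x (D.basis s)

variable {cs D}

lemma IsRoot.action {v : V} (hv : D.IsRoot cs v) (w : W) : D.IsRoot cs (D.action cs w v) := by
  obtain ⟨x, s, rfl⟩ := hv
  exact ⟨w * x, s, (D.action_mul_apply cs w x _).symm⟩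

lemma IsRoot.ne_zero {v : V} (hv : D.IsRoot cs v) : v ≠ 0 := by
  obtain ⟨x, s, rfl⟩ := hv
  simpa using D.basis.ne_zero s

lemma IsRoot.nonneg_or_nonneg_neg {v : V} (hv : D.IsRoot cs v) : D.Nonneg v ∨ D.Nonneg (-v) := by
  obtain ⟨x, s, rfl⟩ := hv
  rcases cs.length_mul_simple x s with h | h
  · exact .inl (D.nonneg_action_basis cs (by omega))
  · right
    have h' : cs.length (x * cs.simple s) < cs.length (x * cs.simple s * cs.simple s) := by
      rw [cs.simple_mul_simple_cancel_right]
      omega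
    have := D.nonneg_action_basis cs h'
    rwa [action_mul_apply, action_simple, reflection_basis, map_neg] at this

lemma IsRoot.nonneg_neg {v : V} (hv : D.IsRoot cs v) (h : ¬ D.Nonneg v) : D.Nonneg (-v) :=
  hv.nonneg_or_nonneg_neg.resolve_left h

lemma IsRoot.not_nonneg_neg {v : V} (hv : D.IsRoot cs v) (h : D.Nonneg v) : ¬ D.Nonneg (-v) :=
  fun h' => hv.ne_zero (h.eq_zero h')

/-- A simple reflection permutes the nonnegative roots that are not multiples of its root. -/
lemma IsRoot.eq_smul_basis {v : V} (hv : D.IsRoot cs v) (h : D.Nonneg v) {s : S}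
    (h' : ¬ D.Nonneg (D.reflection s v)) : ∃ c : ℝ, 0 < c ∧ v = c • D.basis s := by
  classical
  have hroot : D.IsRoot cs (D.reflection s v) := by
    rw [← D.action_simple cs]
    exact hv.action _
  have hneg := hroot.nonneg_neg h'
  rw [reflection_apply] at hneg
  -- The reflection changes only the coordinate at `s`, so every other coordinate is both
  -- non-negative and non-positive.
  have hv' : v = D.basis.repr v s • D.basis s := by
    apply D.basis.ext_elem
    intro t
    by_cases hts : t = s
    · subst hts
      simp
    · have h1 := hneg t
      have h2 := h t
      simp only [map_neg, map_sub, map_smul, Module.Basis.repr_self, Finsupp.coe_neg,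
        Finsupp.coe_sub, Finsupp.coe_smul, Pi.neg_apply, Pi.sub_apply, Pi.smul_apply,
        Finsupp.single_eq_of_ne hts, smul_zero, sub_zero] at h1 ⊢
      linarith
  refine ⟨_, lt_of_le_of_ne (h s) fun h0 => hv.ne_zero ?_, hv'⟩
  rw [hv', ← h0, zero_smul]

variable (cs D)

lemma length_le_longestElement [Finite W] (w : W) :
    cs.length w ≤ cs.length (longestElement cs) :=
  (Finite.exists_max cs.length).choose_spec w

/-- By maximal length every `s` is a right descent of the inverse of the longest element, which
therefore makes every simple root negative; non-negative combinations follow. -/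
lemma nonneg_neg_action_longestElement_inv [Finite W] {v : V} (hv : D.Nonneg v) :
    D.Nonneg (-D.action cs (longestElement cs)⁻¹ v) := by
  have hs : ∀ s, D.Nonneg (-D.action cs (longestElement cs)⁻¹ (D.basis s)) := by
    intro s
    have h : cs.length ((longestElement cs)⁻¹ * cs.simple s) <
        cs.length ((longestElement cs)⁻¹ * cs.simple s * cs.simple s) := by
      rw [cs.simple_mul_simple_cancel_right]
      have h1 := cs.length_mul_simple (longestElement cs)⁻¹ s
      have h2 := length_le_longestElement cs ((longestElement cs)⁻¹ * cs.simple s)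
      rw [← cs.length_inv (longestElement cs)] at h2
      omega
    have := D.nonneg_action_basis cs h
    rwa [action_mul_apply, action_simple, reflection_basis, map_neg] at this
  rw [← D.basis.linearCombination_repr v, Finsupp.linearCombination_apply, Finsupp.sum,
    map_sum, ← Finset.sum_neg_distrib]
  refine Finset.sum_induction _ D.Nonneg (fun _ _ => Nonneg.add) (fun s => by simp) fun s _ => ?_
  rw [map_smul, ← smul_neg]
  exact (hs s).smul (hv s)

variable {cs D} in
lemma IsRoot.not_nonneg_action_longestElement_inv [Finite W] {v : V} (hv : D.IsRoot cs v)
    (h : D.Nonneg v) : ¬ D.Nonneg (D.action cs (longestElement cs)⁻¹ v) := fun h' =>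
  (hv.action _).not_nonneg_neg h' (D.nonneg_neg_action_longestElement_inv cs h)

lemma inner_weight [Finite S] (v : V) (s : S) :
    ⟪v, D.weight s⟫ = D.basis.repr v s * (⟪D.basis s, D.basis s⟫ / 2) := by
  classical
  have := Fintype.ofFinite S
  conv_lhs => rw [← D.basis.sum_repr v]
  rw [sum_inner, Finset.sum_eq_single s]
  · rw [real_inner_smul_left, inner_basis_weight, if_pos rfl]
  · intro t _ hts
    rw [real_inner_smul_left, inner_basis_weight, if_neg hts, mul_zero]
  · simp

variable {D} in
lemma Nonneg.inner_weight_nonneg [Finite S] {v : V} (hv : D.Nonneg v) (s : S) :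
    0 ≤ ⟪v, D.weight s⟫ := by
  rw [inner_weight]
  exact mul_nonneg (hv s) (half_pos (D.inner_basis_self_pos s)).le

lemma inner_basis_weight_pos [Finite S] (s : S) : 0 < ⟪D.basis s, D.weight s⟫ := by
  rw [inner_basis_weight, if_pos rfl]
  exact half_pos (D.inner_basis_self_pos s)

end SimpleRoots

end RootSigns

/-! ### Partial products along a word, and facets as complements of reduced words. -/

section PartialProducts

variable {S : Type*} {M : CoxeterMatrix S} {W : Type*} [Group W] (cs : CoxeterSystem M W)
variable {m : ℕ} (Q : Fin m → S)

/-- The letters of `Q` at the first `n` positions that are not in `I`. -/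
def partialWord (I : Finset (Fin m)) (n : ℕ) : List S :=
  (((List.finRange m).take n).filter (· ∉ I)).map Q

/-- The product of the letters of `Q` at the first `n` positions that are not in `I`. -/
def partialProd (I : Finset (Fin m)) (n : ℕ) : W := cs.wordProd (partialWord Q I n)

lemma partialWord_succ (I : Finset (Fin m)) (k : Fin m) :
    partialWord Q I (k + 1) = partialWord Q I k ++ if k ∈ I then [] else [Q k] := by
  rw [partialWord, partialWord, List.take_add_one]
  split_ifs with h <;> simp [h]

@[simp] lemma partialProd_zero (I : Finset (Fin m)) : partialProd cs Q I 0 = 1 := by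
  simp [partialProd, partialWord]

lemma partialProd_succ_of_mem {I : Finset (Fin m)} {k : Fin m} (h : k ∈ I) :
    partialProd cs Q I (k + 1) = partialProd cs Q I k := by
  rw [partialProd, partialWord_succ, if_pos h, List.append_nil, partialProd]

lemma partialProd_succ_of_notMem {I : Finset (Fin m)} {k : Fin m} (h : k ∉ I) :
    partialProd cs Q I (k + 1) = partialProd cs Q I k * cs.simple (Q k) := by
  rw [partialProd, partialWord_succ, if_neg h, cs.wordProd_append, cs.wordProd_singleton,
    partialProd]

lemma partialWord_length (I : Finset (Fin m)) : partialWord Q I m = subword Q Iᶜ := by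
  simp [partialWord, subword, List.take_of_length_le]

lemma subword_Iio_sdiff (I : Finset (Fin m)) (k : Fin m) :
    subword Q (Finset.Iio k \ I) = partialWord Q I k := by
  rw [subword, partialWord]
  congr 1
  conv_lhs => rw [← List.take_append_drop (k : ℕ) (List.finRange m), List.filter_append]
  have h2 : ((List.finRange m).drop k).filter (· ∈ Finset.Iio k \ I) = [] := by
    rw [List.filter_eq_nil_iff]
    intro a ha
    obtain ⟨n, hn, rfl⟩ := List.mem_iff_getElem.mp ha
    simp [Fin.lt_def]
  rw [h2, List.append_nil]
  apply List.filter_congr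
  intro a ha
  obtain ⟨n, hn, rfl⟩ := List.mem_iff_getElem.mp ha
  simp only [List.length_take, List.length_finRange, lt_inf_iff] at hn
  simp [Fin.lt_def, hn.1]

lemma prefixProd_eq (I : Finset (Fin m)) (k : Fin m) :
    prefixProd cs Q I k = partialProd cs Q I k := by
  rw [prefixProd, subword_Iio_sdiff, partialProd]

lemma length_subword (A : Finset (Fin m)) : (subword Q A).length = A.card := by
  rw [subword, List.length_map, ← List.toFinset_card_of_nodup ((List.nodup_finRange m).filter _)]
  congr 1
  ext
  simp

lemma partialProd_congr_left {I J : Finset (Fin m)} {n : ℕ} (hn : n ≤ m)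
    (h : ∀ k : Fin m, (k : ℕ) < n → (k ∈ I ↔ k ∈ J)) :
    partialProd cs Q I n = partialProd cs Q J n := by
  induction n with
  | zero => simp
  | succ n ih =>
    have ih' := ih (by omega) fun k hk => h k (by omega)
    have hk := h ⟨n, hn⟩ (Nat.lt_succ_self n)
    by_cases hI : (⟨n, hn⟩ : Fin m) ∈ I
    · have h1 := partialProd_succ_of_mem cs Q hI
      have h2 := partialProd_succ_of_mem cs Q (hk.mp hI)
      exact h1.trans (ih'.trans h2.symm)
    · have h1 := partialProd_succ_of_notMem cs Q hI
      have h2 := partialProd_succ_of_notMem cs Q (fun h => hI (hk.mpr h))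
      exact h1.trans ((congrArg (· * _) ih').trans h2.symm)

/-- With equal total products, the letters can be cancelled from the right end. -/
lemma partialProd_congr_right {I J : Finset (Fin m)}
    (hm : partialProd cs Q I m = partialProd cs Q J m) {n : ℕ} (hn : n ≤ m)
    (h : ∀ k : Fin m, n ≤ (k : ℕ) → (k ∈ I ↔ k ∈ J)) :
    partialProd cs Q I n = partialProd cs Q J n := by
  induction hn using Nat.decreasingInduction with
  | self => exact hm
  | of_succ n hn ih =>
    have ih' := ih fun k hk => h k (by omega)
    have hk := h ⟨n, hn⟩ le_rfl
    by_cases hI : (⟨n, hn⟩ : Fin m) ∈ I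
    · have h1 := partialProd_succ_of_mem cs Q hI
      have h2 := partialProd_succ_of_mem cs Q (hk.mp hI)
      exact h1.symm.trans (ih'.trans h2)
    · have h1 := partialProd_succ_of_notMem cs Q hI
      have h2 := partialProd_succ_of_notMem cs Q (fun h => hI (hk.mpr h))
      exact mul_right_cancel (h1.symm.trans (ih'.trans h2))

variable {cs Q}

/-- All reduced expressions of the longest element have the same length, so a reduced expression
inside the complement of a facet must fill it. -/
lemma isFacet_iff [Finite W] {I : Finset (Fin m)} :
    IsFacet cs Q I ↔ cs.IsReduced (subword Q Iᶜ) ∧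
      cs.wordProd (subword Q Iᶜ) = longestElement cs := by
  constructor
  · intro hI
    obtain ⟨A, hA, hred, hprod⟩ := hI.prop
    have h1 : Aᶜ ∈ subwordComplex cs Q (longestElement cs) := ⟨A, by simp, hred, hprod⟩
    have h2 := hI.eq_of_le h1 (Finset.subset_compl_comm.mp hA)
    rw [h2, compl_compl]
    exact ⟨hred, hprod⟩
  · rintro ⟨hred, hprod⟩
    refine ⟨⟨Iᶜ, subset_rfl, hred, hprod⟩, ?_⟩
    rintro J ⟨A, hA, hred', hprod'⟩ hIJ
    have h1 := hred.eq
    have h2 := hred'.eq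
    rw [hprod, length_subword] at h1
    rw [hprod', length_subword] at h2
    have h3 : Jᶜ ⊆ Iᶜ := Finset.compl_subset_compl.mpr hIJ
    have h4 : A = Iᶜ := Finset.eq_of_subset_of_card_le (hA.trans h3) (by omega)
    rw [h4] at hA
    exact Finset.compl_subset_compl.mp hA

lemma isFacet_iff_card [Finite W] {I : Finset (Fin m)} :
    IsFacet cs Q I ↔ Iᶜ.card = cs.length (longestElement cs) ∧
      partialProd cs Q I m = longestElement cs := by
  rw [isFacet_iff, partialProd, partialWord_length, CoxeterSystem.IsReduced, length_subword]
  constructor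
  · rintro ⟨h1, h2⟩
    rw [h2] at h1
    exact ⟨h1.symm, h2⟩
  · rintro ⟨h1, h2⟩
    exact ⟨by rw [h2, h1], h2⟩

lemma IsFacet.length_partialProd_lt [Finite W] {I : Finset (Fin m)} (hI : IsFacet cs Q I)
    {k : Fin m} (hk : k ∉ I) :
    cs.length (partialProd cs Q I k) < cs.length (partialProd cs Q I k * cs.simple (Q k)) := by
  have hred := (isFacet_iff.mp hI).1
  rw [← partialWord_length] at hred
  have hpre : partialWord Q I (k + 1) <+: partialWord Q I m := by
    rw [partialWord, partialWord]
    exact ((List.take_prefix_take_left (l := List.finRange m) k.isLt).filter _).map _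
  have hred' : cs.IsReduced (partialWord Q I (k + 1)) := by
    rw [List.prefix_iff_eq_take.mp hpre]
    exact hred.take _
  rw [← partialProd_succ_of_notMem cs Q hk, partialProd, partialProd, hred'.eq,
    partialWord_succ, if_neg hk]
  have := cs.length_wordProd_le (partialWord Q I k)
  simp only [List.length_append, List.length_singleton]
  omega

end PartialProducts

/-! ### Flips of facets and their effect on roots and brick vectors. -/

section Flips

variable {S : Type*} {M : CoxeterMatrix S} {W : Type*} [Group W] {cs : CoxeterSystem M W}
variable {V : Type*} [NormedAddCommGroup V] [InnerProductSpace ℝ V] {D : SimpleRoots M V}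
variable {m : ℕ} {Q : Fin m → S}

lemma rootFunction_eq (I : Finset (Fin m)) (k : Fin m) :
    rootFunction cs D Q I k = D.action cs (partialProd cs Q I k) (D.basis (Q k)) := by
  rw [rootFunction, prefixProd_eq]

lemma weightFunction_eq [Finite S] (I : Finset (Fin m)) (k : Fin m) :
    weightFunction cs D Q I k = D.action cs (partialProd cs Q I k) (D.weight (Q k)) := by
  rw [weightFunction, prefixProd_eq]

lemma isRoot_rootFunction (I : Finset (Fin m)) (k : Fin m) :
    D.IsRoot cs (rootFunction cs D Q I k) :=
  ⟨_, _, rootFunction_eq I k⟩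

lemma IsFacet.nonneg_rootFunction [Finite W] {I : Finset (Fin m)} (hI : IsFacet cs Q I)
    {k : Fin m} (hk : k ∉ I) : D.Nonneg (rootFunction cs D Q I k) := by
  rw [rootFunction_eq]
  exact D.nonneg_action_basis cs (hI.length_partialProd_lt hk)

variable (cs D) in
/-- The action of the Coxeter group is faithful. -/
lemma SimpleRoots.eq_of_action_eq {w w' : W} (h : ∀ v, D.action cs w v = D.action cs w' v) :
    w = w' := by
  suffices w'⁻¹ * w = 1 by simpa [inv_mul_eq_one, eq_comm] using this
  have h1 : ∀ v, D.action cs (w'⁻¹ * w) v = v := fun v => by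
    rw [D.action_mul_apply, h, D.action_inv_action]
  by_contra hne
  obtain ⟨s, hs⟩ := cs.exists_rightDescent_of_ne_one hne
  have h2 : cs.length (w'⁻¹ * w * cs.simple s) <
      cs.length (w'⁻¹ * w * cs.simple s * cs.simple s) := by
    rwa [cs.simple_mul_simple_cancel_right]
  have h3 := D.nonneg_action_basis cs h2
  rw [D.action_mul_apply, h1, D.action_simple, D.reflection_basis] at h3
  exact D.basis.ne_zero s ((D.nonneg_basis s).eq_zero h3)

/-- Exchanging `i` for `j` multiplies the partial products between `i` and `j` by a reflection. -/
lemma partialProd_exchange {I : Finset (Fin m)} {i j : Fin m} (hi : i ∈ I) (hj : j ∉ I) {t : W}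
    (hti : partialProd cs Q I i * cs.simple (Q i) = t * partialProd cs Q I i)
    (htj : partialProd cs Q I j * cs.simple (Q j) = t * partialProd cs Q I j)
    (ht : t * t = 1) {n : ℕ} (hn : n ≤ m) :
    partialProd cs Q (insert j (I.erase i)) n =
      if ((i : ℕ) < n ↔ (j : ℕ) < n) then partialProd cs Q I n else t * partialProd cs Q I n := by
  have hij : i ≠ j := fun h => hj (h ▸ hi)
  have htt : ∀ x : W, t * (t * x) = x := fun x => by rw [← mul_assoc, ht, one_mul]
  induction n with
  | zero => simp
  | succ n ih =>
    obtain ⟨k, rfl⟩ : ∃ k : Fin m, n = k := ⟨⟨n, hn⟩, rfl⟩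
    have ih' := ih (by omega)
    have hne : (i : ℕ) ≠ j := fun h => hij (Fin.ext h)
    by_cases hki : k = i
    · subst hki
      have hkJ : k ∉ insert j (I.erase k) := by simp [hij]
      -- Passing `i` or `j` toggles whether the current index lies between them; this treats both
      -- orders of `i` and `j` at once.
      have hiff : ((k : ℕ) < k + 1 ↔ (j : ℕ) < k + 1) ↔ ¬ ((k : ℕ) < k ↔ (j : ℕ) < k) := by omega
      rw [partialProd_succ_of_notMem cs Q hkJ, partialProd_succ_of_mem cs Q hi, ih']
      by_cases h : ((k : ℕ) < k ↔ (j : ℕ) < k)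
      · rw [if_pos h, if_neg (fun h' => hiff.mp h' h), hti]
      · rw [if_neg h, if_pos (hiff.mpr h), mul_assoc, hti, htt]
    by_cases hkj : k = j
    · subst hkj
      have hkJ : k ∈ insert k (I.erase i) := by simp
      have hiff : ((i : ℕ) < k + 1 ↔ (k : ℕ) < k + 1) ↔ ¬ ((i : ℕ) < k ↔ (k : ℕ) < k) := by omega
      rw [partialProd_succ_of_mem cs Q hkJ, partialProd_succ_of_notMem cs Q hj, ih']
      by_cases h : ((i : ℕ) < k ↔ (k : ℕ) < k)
      · rw [if_pos h, if_neg (fun h' => hiff.mp h' h), htj, htt]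
      · rw [if_neg h, if_pos (hiff.mpr h), htj]
    have h1 : (k : ℕ) ≠ i := fun h => hki (Fin.ext h)
    have h2 : (k : ℕ) ≠ j := fun h => hkj (Fin.ext h)
    have hiff : ((i : ℕ) < k + 1 ↔ (j : ℕ) < k + 1) ↔ ((i : ℕ) < k ↔ (j : ℕ) < k) := by omega
    rw [if_congr hiff rfl rfl]
    by_cases hkI : k ∈ I
    · have hkJ : k ∈ insert j (I.erase i) := by simp [hki, hkI]
      rw [partialProd_succ_of_mem cs Q hkJ, partialProd_succ_of_mem cs Q hkI, ih']
    · have hkJ : k ∉ insert j (I.erase i) := by simp [hkj, hkI]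
      rw [partialProd_succ_of_notMem cs Q hkJ, partialProd_succ_of_notMem cs Q hkI, ih']
      split_ifs
      · rfl
      · rw [mul_assoc]

/-- The sign of a root, seen along the partial products, can change from `+` to `-` only at a
position whose root is positively proportional to it. -/
lemma eq_smul_of_nonneg_of_not_nonneg {I : Finset (Fin m)} {γ : V} (hγ : D.IsRoot cs γ)
    {k : Fin m} (h : D.Nonneg (D.action cs (partialProd cs Q I k)⁻¹ γ))
    (h' : ¬ D.Nonneg (D.action cs (partialProd cs Q I (k + 1))⁻¹ γ)) :
    k ∉ I ∧ ∃ c : ℝ, 0 < c ∧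
      D.action cs (partialProd cs Q I k)⁻¹ γ = c • D.basis (Q k) := by
  by_cases hk : k ∈ I
  · rw [partialProd_succ_of_mem cs Q hk] at h'
    exact absurd h h'
  · refine ⟨hk, (hγ.action _).eq_smul_basis h ?_⟩
    rwa [partialProd_succ_of_notMem cs Q hk, mul_inv_rev, cs.inv_simple,
      SimpleRoots.action_mul_apply, SimpleRoots.action_simple] at h'

lemma eq_neg_smul_of_not_nonneg_of_nonneg {I : Finset (Fin m)} {γ : V} (hγ : D.IsRoot cs γ)
    {k : Fin m} (h : ¬ D.Nonneg (D.action cs (partialProd cs Q I k)⁻¹ γ))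
    (h' : D.Nonneg (D.action cs (partialProd cs Q I (k + 1))⁻¹ γ)) :
    k ∉ I ∧ ∃ c : ℝ, 0 < c ∧
      D.action cs (partialProd cs Q I k)⁻¹ γ = -(c • D.basis (Q k)) := by
  by_cases hk : k ∈ I
  · rw [partialProd_succ_of_mem cs Q hk] at h'
    exact absurd h' h
  · refine ⟨hk, ?_⟩
    rw [partialProd_succ_of_notMem cs Q hk, mul_inv_rev, cs.inv_simple,
      SimpleRoots.action_mul_apply, SimpleRoots.action_simple] at h'
    rw [← D.reflection_reflection (Q k) (D.action cs (partialProd cs Q I k)⁻¹ γ)] at h ⊢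
    have hroot : D.IsRoot cs (D.reflection (Q k) (D.action cs (partialProd cs Q I k)⁻¹ γ)) := by
      rw [← D.action_simple cs]
      exact (hγ.action _).action _
    obtain ⟨c, hc, heq⟩ := hroot.eq_smul_basis h' h
    refine ⟨c, hc, ?_⟩
    rw [heq, map_smul, SimpleRoots.reflection_basis, smul_neg]

/-- Every position `i` of a facet has a partner `j` outside the facet whose root is proportional to
that of `i`; between the two, the root of `i` is nonnegative. -/
lemma IsFacet.exists_partner [Finite W] {I : Finset (Fin m)} (hI : IsFacet cs Q I) {i : Fin m}
    (hi : i ∈ I) : ∃ j, j ∉ I ∧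
      (∀ n ≤ m, ¬ ((i : ℕ) < n ↔ (j : ℕ) < n) →
        D.Nonneg (D.action cs (partialProd cs Q I n)⁻¹ (rootFunction cs D Q I i))) ∧
      ∃ c : ℝ, 0 < c ∧ D.action cs (partialProd cs Q I j)⁻¹ (rootFunction cs D Q I i) =
        (if i < j then c else -c) • D.basis (Q j) := by
  classical
  set γ := rootFunction cs D Q I i with hγdef
  have hγ : D.IsRoot cs γ := isRoot_rootFunction I i
  let pos := fun n => D.Nonneg (D.action cs (partialProd cs Q I n)⁻¹ γ)
  have hpi : pos i := by
    simp only [pos]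
    rw [hγdef, rootFunction_eq, SimpleRoots.action_inv_action]
    exact D.nonneg_basis _
  -- At `n = i` the root is simple, hence positive. If it turns negative later, the first change
  -- gives a partner to the right of `i`.
  by_cases hex : ∃ n, (i : ℕ) ≤ n ∧ n ≤ m ∧ ¬ pos n
  · have hN := Nat.find_spec hex
    have hmin := fun l => Nat.find_min hex (m := l)
    set N := Nat.find hex
    have hNi : N ≠ i := fun h => hN.2.2 (h ▸ hpi)
    obtain ⟨k, hk⟩ : ∃ k : Fin m, N = k + 1 := ⟨⟨N - 1, by omega⟩, by simp only; omega⟩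
    have hik : (i : ℕ) ≤ k := by omega
    have hposle : ∀ n, (i : ℕ) ≤ n → n ≤ k → pos n := by
      intro n h1 h2
      by_contra h3
      exact hmin n (by omega) ⟨h1, by omega, h3⟩
    have hneg := hN.2.2
    rw [hk] at hneg
    obtain ⟨hkI, c, hc, heq⟩ := eq_smul_of_nonneg_of_not_nonneg hγ (hposle k hik le_rfl) hneg
    have hne : (i : ℕ) ≠ k := fun h => hkI ((Fin.ext h : i = k) ▸ hi)
    have hlt : i < k := Fin.lt_def.mpr (by omega)
    refine ⟨k, hkI, fun n _ hn => hposle n (by omega) (by omega), c, hc, ?_⟩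
    rw [if_pos hlt, heq]
  · push Not at hex
    -- Otherwise it is still positive at the end, where the whole longest element has been undone,
    -- so it was negative at the start. The last change to positive before `i` gives the partner.
    have h0 : ¬ pos 0 := by
      intro h0
      refine hγ.not_nonneg_action_longestElement_inv ?_ ?_
      · simp only [pos, partialProd_zero, inv_one, map_one] at h0
        exact h0
      · have := hex m i.isLt.le le_rfl
        simp only [pos] at this
        rwa [(isFacet_iff_card.mp hI).2] at this
    have hN := Nat.findGreatest_spec (P := fun n => ¬ pos n) (Nat.zero_le i) h0
    have hNle := Nat.findGreatest_le (P := fun n => ¬ pos n) i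
    have hmax := fun l => Nat.findGreatest_is_greatest (P := fun n => ¬ pos n) (n := i) (k := l)
    set N := Nat.findGreatest (fun n => ¬ pos n) i
    have hNi : N ≠ i := fun h => hN (h ▸ hpi)
    obtain ⟨k, hk⟩ : ∃ k : Fin m, N = k := ⟨⟨N, by omega⟩, rfl⟩
    rw [hk] at hN hNle hNi hmax
    have hposle : ∀ n, (k : ℕ) < n → n ≤ i → pos n := fun n h1 h2 => not_not.mp (hmax n h1 h2)
    obtain ⟨hkI, c, hc, heq⟩ := eq_neg_smul_of_not_nonneg_of_nonneg hγ hN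
      (hposle _ (Nat.lt_succ_self _) (by omega))
    have hlt : ¬ i < k := by rw [Fin.lt_def]; omega
    refine ⟨k, hkI, fun n _ hn => hposle n (by omega) (by omega), c, hc, ?_⟩
    rw [if_neg hlt, heq, neg_smul]

/-- `J` is obtained from `I` by flipping the position `i` to the position `j`. -/
structure IsFlip [Finite S] (cs : CoxeterSystem M W) (D : SimpleRoots M V) (Q : Fin m → S)
    (I J : Finset (Fin m)) (i j : Fin m) : Prop where
  eq_insert : J = insert j (I.erase i)
  notMem : j ∉ I
  rootFunction_right : ∃ c : ℝ, 0 < c ∧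
    rootFunction cs D Q J j = -(c • rootFunction cs D Q I i)
  rootFunction_or : ∀ k, rootFunction cs D Q J k = rootFunction cs D Q I k ∨
    rootFunction cs D Q J k = reflectionIn (rootFunction cs D Q I i) (rootFunction cs D Q I k)
  brickVector_eq : ∃ c : ℝ, 0 < c ∧
    brickVector cs D Q J = brickVector cs D Q I - c • rootFunction cs D Q I i

theorem IsFacet.exists_flip [Finite S] [Finite W] {I : Finset (Fin m)} (hI : IsFacet cs Q I)
    {i : Fin m} (hi : i ∈ I) : ∃ J j, IsFacet cs Q J ∧ IsFlip cs D Q I J i j := by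
  obtain ⟨j, hj, hpos, c, hc, heq⟩ := hI.exists_partner (D := D) hi
  have hij : i ≠ j := fun h => hj (h ▸ hi)
  set γ := rootFunction cs D Q I i with hγdef
  have hγ : D.IsRoot cs γ := isRoot_rootFunction I i
  set c' : ℝ := if i < j then c else -c with hc'
  have hc'0 : c' ≠ 0 := by
    rw [hc']
    split_ifs
    · exact hc.ne'
    · exact (neg_neg_of_pos hc).ne
  have hγj : γ = c' • rootFunction cs D Q I j := by
    rw [rootFunction_eq, ← map_smul, ← heq, SimpleRoots.action_action_inv]
  have hIj : rootFunction cs D Q I j = c'⁻¹ • γ := by rw [hγj, inv_smul_smul₀ hc'0]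
  set t := partialProd cs Q I i * cs.simple (Q i) * (partialProd cs Q I i)⁻¹ with ht
  have hact : ∀ v, D.action cs t v = reflectionIn γ v := fun v => by
    rw [ht, D.action_conj, hγdef, rootFunction_eq]
  -- Proportional roots define the same reflection, and the action is faithful, so `t` is also the
  -- group element attached to `j`.
  have htj' : t = partialProd cs Q I j * cs.simple (Q j) * (partialProd cs Q I j)⁻¹ := by
    apply D.eq_of_action_eq cs
    intro v
    rw [hact, D.action_conj, ← rootFunction_eq, hIj, reflectionIn_smul (inv_ne_zero hc'0)]
  have hti : partialProd cs Q I i * cs.simple (Q i) = t * partialProd cs Q I i := by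
    rw [ht, inv_mul_cancel_right]
  have htj : partialProd cs Q I j * cs.simple (Q j) = t * partialProd cs Q I j := by
    rw [htj', inv_mul_cancel_right]
  have htt : t * t = 1 := by
    rw [ht]
    simp [mul_assoc]
  set J := insert j (I.erase i) with hJ
  have hP : ∀ n ≤ m, partialProd cs Q J n = if ((i : ℕ) < n ↔ (j : ℕ) < n) then
      partialProd cs Q I n else t * partialProd cs Q I n := fun n hn =>
    partialProd_exchange hi hj hti htj htt hn
  have hPk : ∀ (k : Fin m) (v : V), D.action cs (partialProd cs Q J k) v =
      if (i < k ↔ j < k) then D.action cs (partialProd cs Q I k) v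
      else reflectionIn γ (D.action cs (partialProd cs Q I k) v) := by
    intro k v
    rw [hP k k.isLt.le]
    simp only [Fin.lt_def]
    split_ifs
    · rfl
    · rw [D.action_mul_apply, hact]
  refine ⟨J, j, ?_, hJ, hj, ?_, ?_, ?_⟩
  -- The exchange preserves both the number of letters used and the total product.
  · rw [isFacet_iff_card] at hI ⊢
    constructor
    · rw [← hI.1, Finset.card_compl, Finset.card_compl, hJ,
        Finset.card_insert_of_notMem (by simp [hj]), Finset.card_erase_add_one hi]
    · rw [hP m le_rfl, if_pos (by simp), hI.2]
  · have hroot : rootFunction cs D Q J j = -(c⁻¹ • γ) := by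
      rw [rootFunction_eq, hPk]
      simp only [lt_irrefl, iff_false, ← rootFunction_eq, hIj]
      -- If `i < j`, the root at `j` is a positive multiple of `γ` and gets reflected. If `j < i`,
      -- it is unchanged but already a negative multiple.
      by_cases hlt : i < j
      · rw [if_neg (not_not.mpr hlt), hc', if_pos hlt]
        conv_lhs => rw [← reflectionIn_smul (inv_ne_zero hc.ne')]
        exact reflectionIn_self (smul_ne_zero (inv_ne_zero hc.ne') hγ.ne_zero)
      · rw [if_pos hlt, hc', if_neg hlt, inv_neg, neg_smul]
    exact ⟨c⁻¹, inv_pos.mpr hc, hroot⟩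
  · intro k
    rw [rootFunction_eq J, rootFunction_eq I k, hPk]
    split_ifs
    · exact .inl rfl
    · exact .inr rfl
  -- `d k` is the multiple of `γ` removed from the `k`-th weight. It is non-negative because the
  -- root of `i`, pulled back between the two positions, is positive and so pairs non-negatively
  -- with fundamental weights.
  · let d : Fin m → ℝ := fun k =>
      if (i < k ↔ j < k) then 0 else 2 * ⟪γ, weightFunction cs D Q I k⟫ / ⟪γ, γ⟫
    have hγγ : 0 < ⟪γ, γ⟫ := real_inner_self_pos.mpr hγ.ne_zero
    have hinner : ∀ k, ⟪γ, weightFunction cs D Q I k⟫ =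
        ⟪D.action cs (partialProd cs Q I k)⁻¹ γ, D.weight (Q k)⟫ := fun k => by
      rw [D.inner_action_left, inv_inv, weightFunction_eq]
    have hd : ∀ k, 0 ≤ d k := by
      intro k
      simp only [d]
      split_ifs with h
      · exact le_rfl
      · have h1 := hpos k k.isLt.le (by simpa only [Fin.lt_def] using h)
        have h2 := h1.inner_weight_nonneg (Q k)
        rw [← hinner] at h2
        positivity
    -- The later of `i` and `j` belongs to the reflected range; there the pulled-back root is a
    -- positive multiple of the simple root dual to the weight.
    have hd' : ∃ k, 0 < d k := by
      by_cases hlt : i < j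
      · refine ⟨j, ?_⟩
        have h1 : ¬ (i < j ↔ j < j) := by simp [hlt]
        simp only [d, if_neg h1]
        rw [hinner, heq, hc', if_pos hlt, real_inner_smul_left]
        have := D.inner_basis_weight_pos (Q j)
        positivity
      · have hji : j < i := lt_of_le_of_ne (not_lt.mp hlt) hij.symm
        refine ⟨i, ?_⟩
        have h1 : ¬ (i < i ↔ j < i) := by simp [hji]
        simp only [d, if_neg h1]
        rw [hinner, hγdef, rootFunction_eq, D.action_inv_action]
        have := D.inner_basis_weight_pos (Q i)
        rw [hγdef, rootFunction_eq] at hγγ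
        positivity
    refine ⟨∑ k, d k, Finset.sum_pos' (fun k _ => hd k) ?_, ?_⟩
    · obtain ⟨k, hk⟩ := hd'
      exact ⟨k, Finset.mem_univ _, hk⟩
    · rw [brickVector, brickVector, Finset.sum_smul, ← Finset.sum_sub_distrib]
      refine Finset.sum_congr rfl fun k _ => ?_
      rw [weightFunction_eq J, hPk, ← weightFunction_eq I]
      simp only [d]
      split_ifs
      · rw [zero_smul, sub_zero]
      · rw [reflectionIn]

end Flips

/-! ### Uniqueness of the facet adapted to a chamber. -/

section GoodFacets

variable {S : Type*} {M : CoxeterMatrix S} {W : Type*} [Group W] {cs : CoxeterSystem M W}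
variable {V : Type*} [NormedAddCommGroup V] [InnerProductSpace ℝ V] {D : SimpleRoots M V}
variable {m : ℕ} {Q : Fin m → S}

lemma rootFunction_congr_left {I J : Finset (Fin m)} {k : Fin m}
    (h : ∀ l < k, (l ∈ I ↔ l ∈ J)) : rootFunction cs D Q I k = rootFunction cs D Q J k := by
  rw [rootFunction_eq, rootFunction_eq, partialProd_congr_left cs Q k.isLt.le fun l hl => h l hl]

/-- The partial products agree just after `k`, but only `J` used the letter there, so the two
products before `k` differ by the simple reflection that negates this root. -/
lemma rootFunction_eq_neg {I J : Finset (Fin m)}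
    (hm : partialProd cs Q I m = partialProd cs Q J m) {k : Fin m} (hkI : k ∈ I) (hkJ : k ∉ J)
    (h : ∀ l, k < l → (l ∈ I ↔ l ∈ J)) :
    rootFunction cs D Q I k = -rootFunction cs D Q J k := by
  have h1 : partialProd cs Q I (k + 1) = partialProd cs Q J (k + 1) :=
    partialProd_congr_right cs Q hm k.isLt fun l hl => h l (Fin.lt_def.mpr hl)
  rw [partialProd_succ_of_mem cs Q hkI, partialProd_succ_of_notMem cs Q hkJ] at h1
  rw [rootFunction_eq, rootFunction_eq, h1, D.action_mul_apply, D.action_simple,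
    D.reflection_basis, map_neg]

lemma IsFacet.partialProd_eq [Finite W] {I J : Finset (Fin m)} (hI : IsFacet cs Q I)
    (hJ : IsFacet cs Q J) : partialProd cs Q I m = partialProd cs Q J m := by
  rw [(isFacet_iff_card.mp hI).2, (isFacet_iff_card.mp hJ).2]

/-- Two facets through a common ridge whose roots at the ridge point in the same direction
coincide. -/
lemma IsFacet.eq_of_erase_eq_erase [Finite W] {I J : Finset (Fin m)} (hI : IsFacet cs Q I)
    (hJ : IsFacet cs Q J) {i j : Fin m} (hi : i ∈ I) (hj : j ∈ J) (h : I.erase i = J.erase j)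
    {β : V} (hβ : β ≠ 0) {a b : ℝ} (ha : 0 < a) (hb : 0 < b)
    (hIi : rootFunction cs D Q I i = a • β) (hJj : rootFunction cs D Q J j = b • β) : I = J := by
  by_cases hij : i = j
  · subst hij
    rw [← Finset.insert_erase hi, h, Finset.insert_erase hj]
  exfalso
  wlog hlt : i < j generalizing I J i j a b
  · exact this hJ hI hj hi h.symm hb ha hJj hIi (Ne.symm hij)
      (lt_of_le_of_ne (not_lt.mp hlt) (Ne.symm hij))
  have hmem : ∀ l, l ≠ i → l ≠ j → (l ∈ I ↔ l ∈ J) := fun l h1 h2 => by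
    have := Finset.ext_iff.mp h l
    simpa [h1, h2] using this
  have hjI : j ∉ I := fun hc => by
    have := Finset.ext_iff.mp h j
    simp [hc, Ne.symm hij] at this
  have hiJ : i ∉ J := fun hc => by
    have := Finset.ext_iff.mp h i
    simp [hc, hij] at this
  -- Agreement to the left of `i` identifies the root of `I` at `i` with one outside `J`, which is
  -- positive. Agreement to the right of `j` makes the root of `J` at `j` the negative of one
  -- outside `I`.
  have h1 : D.Nonneg β := by
    rw [← D.nonneg_smul_iff ha, ← hIi, rootFunction_congr_left (J := J) fun l hl =>
      hmem l hl.ne (hl.trans hlt).ne]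
    exact hJ.nonneg_rootFunction hiJ
  have h2 : D.Nonneg (-β) := by
    rw [← D.nonneg_smul_iff hb, smul_neg, ← hJj,
      rootFunction_eq_neg (hJ.partialProd_eq hI) hj hjI fun l hl =>
      (hmem l (hlt.trans hl).ne' hl.ne').symm, neg_neg]
    exact hI.nonneg_rootFunction hjI
  exact hβ (h1.eq_zero h2)

/-- The root configuration of `I` consists of `w`-images of nonnegative roots. -/
def IsGood (cs : CoxeterSystem M W) (D : SimpleRoots M V) (Q : Fin m → S) (w : W)
    (I : Finset (Fin m)) : Prop :=
  ∀ i ∈ I, D.Nonneg (D.action cs w⁻¹ (rootFunction cs D Q I i))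

/-- At the last position where the facets differ, the root of the facet containing it is opposite to
a root outside the other facet, hence negative. -/
lemma IsGood.eq_of_one [Finite W] {I J : Finset (Fin m)} (hI : IsFacet cs Q I)
    (hJ : IsFacet cs Q J) (hgI : IsGood cs D Q 1 I) (hgJ : IsGood cs D Q 1 J) : I = J := by
  by_contra hne
  have hns : (symmDiff I J).Nonempty := by
    rw [Finset.nonempty_iff_ne_empty]
    intro h
    exact hne (symmDiff_eq_bot.mp h)
  obtain ⟨k, hk, hmax⟩ := (symmDiff I J).exists_max_image id hns
  have hagree : ∀ l, k < l → (l ∈ I ↔ l ∈ J) := by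
    intro l hl
    by_contra hc
    have : l ∈ symmDiff I J := by
      rw [Finset.mem_symmDiff]
      tauto
    exact absurd (hmax l this) (not_le.mpr hl)
  clear hmax hns
  wlog hkI : k ∈ I generalizing I J
  · refine this hJ hI hgJ hgI (Ne.symm hne) (symmDiff_comm I J ▸ hk)
      (fun l hl => (hagree l hl).symm) ?_
    rw [Finset.mem_symmDiff] at hk
    tauto
  have hkJ : k ∉ J := by
    rw [Finset.mem_symmDiff] at hk
    tauto
  have h1 := hgI k hkI
  rw [inv_one, map_one] at h1
  change D.Nonneg (rootFunction cs D Q I k) at h1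
  rw [rootFunction_eq_neg (hI.partialProd_eq hJ) hkI hkJ hagree] at h1
  exact (isRoot_rootFunction J k).not_nonneg_neg (hJ.nonneg_rootFunction hkJ) h1

lemma eq_of_rootFunction_eq_smul {I : Finset (Fin m)}
    (hli : LinearIndependent ℝ (rootConfiguration cs D Q I)) {i j : Fin m} (hi : i ∈ I)
    (hj : j ∈ I) {c : ℝ} (h : rootFunction cs D Q I i = c • rootFunction cs D Q I j) : i = j := by
  by_contra hne
  have := hli.notMem_span_image (s := {⟨j, hj⟩}) (x := ⟨i, hi⟩) (by simpa using hne)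
  rw [Set.image_singleton] at this
  exact this (Submodule.mem_span_singleton.mpr ⟨c, h.symm⟩)

/-- Crossing a wall of the chamber of `w`: a `w`-good facet is either `w s`-good or becomes so after
a flip. -/
lemma IsGood.mul_simple [Finite S] [Finite W] {w : W} {I : Finset (Fin m)} (hI : IsFacet cs Q I)
    (hli : LinearIndependent ℝ (rootConfiguration cs D Q I)) (hg : IsGood cs D Q w I) (s : S) :
    IsGood cs D Q (w * cs.simple s) I ∨ ∃ J i j, IsFacet cs Q J ∧ i ∈ I ∧ IsFlip cs D Q I J i j ∧
      IsGood cs D Q (w * cs.simple s) J ∧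
      ∃ c : ℝ, 0 < c ∧ rootFunction cs D Q I i = c • D.action cs w (D.basis s) := by
  have hinv : ∀ v, D.action cs (w * cs.simple s)⁻¹ v = D.reflection s (D.action cs w⁻¹ v) := by
    intro v
    rw [mul_inv_rev, cs.inv_simple, D.action_mul_apply, D.action_simple]
  -- Among the roots made positive by `w⁻¹`, the simple reflection turns negative only those on the
  -- ray of the wall `w α_s`.
  have hstay : ∀ k ∈ I, (¬ ∃ c : ℝ, 0 < c ∧
      rootFunction cs D Q I k = c • D.action cs w (D.basis s)) →
      D.Nonneg (D.action cs (w * cs.simple s)⁻¹ (rootFunction cs D Q I k)) := by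
    intro k hk hne
    rw [hinv]
    by_contra hc
    obtain ⟨c, hc, heq⟩ := ((isRoot_rootFunction I k).action _).eq_smul_basis (hg k hk) hc
    refine hne ⟨c, hc, ?_⟩
    rw [← map_smul, ← heq, D.action_action_inv]
  by_cases hex : ∃ i ∈ I, ∃ c : ℝ, 0 < c ∧
      rootFunction cs D Q I i = c • D.action cs w (D.basis s)
  · right
    obtain ⟨i, hi, c, hc, hic⟩ := hex
    obtain ⟨J, j, hJ, hflip⟩ := hI.exists_flip (D := D) hi
    refine ⟨J, i, j, hJ, hi, hflip, ?_, c, hc, hic⟩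
    intro k hk
    by_cases hkj : k = j
    · subst hkj
      obtain ⟨c', hc', heq⟩ := hflip.rootFunction_right
      rw [heq, hic, smul_smul, map_neg, map_smul, hinv, D.action_inv_action, D.reflection_basis,
        smul_neg, neg_neg]
      exact (D.nonneg_basis s).smul (by positivity)
    · rw [hflip.eq_insert, Finset.mem_insert, Finset.mem_erase] at hk
      obtain ⟨hki, hkI⟩ := hk.resolve_left hkj
      rcases hflip.rootFunction_or k with h | h
      · rw [h]
        refine hstay k hkI ?_
        rintro ⟨c', hc', heq⟩
        refine hki (eq_of_rootFunction_eq_smul hli hkI hi (c := c' / c) ?_)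
        rw [heq, hic, smul_smul, div_mul_cancel₀ _ hc.ne']
      -- The reflection in the flipped root cancels the wall crossing, so goodness for `w` applies
      -- as it stands.
      · rw [h, hic, reflectionIn_smul hc.ne', hinv, map_reflectionIn, D.action_inv_action,
          D.reflectionIn_basis, D.reflection_reflection]
        exact hg k hkI
  · left
    intro k hk
    exact hstay k hk fun h => hex ⟨k, hk, h⟩

lemma IsFlip.erase_eq [Finite S] {I J : Finset (Fin m)} {i j : Fin m}
    (h : IsFlip cs D Q I J i j) : J.erase j = I.erase i := by
  rw [h.eq_insert, Finset.erase_insert]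
  simp [h.notMem]

/-- There is at most one `w`-good facet. -/
theorem IsRealizing.eq_of_isGood [Finite S] [Finite W] (hQ : IsRealizing cs D Q) (w : W) :
    ∀ {I J : Finset (Fin m)}, IsFacet cs Q I → IsFacet cs Q J → IsGood cs D Q w I →
      IsGood cs D Q w J → I = J := by
  induction w using cs.simple_induction_right with
  | one => exact fun hI hJ => IsGood.eq_of_one hI hJ
  | mul_simple_right w s ih =>
    have hback : w * cs.simple s * cs.simple s = w := cs.simple_mul_simple_cancel_right s
    -- One facet cannot stay while the other flips onto it: the flip leaves behind a negative
    -- multiple of the wall root, which is not allowed in a facet good for `w s`.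
    have mixed : ∀ {I J K : Finset (Fin m)} {j k : Fin m}, IsGood cs D Q (w * cs.simple s) I →
        K = I → IsFlip cs D Q J K j k → (∃ c : ℝ, 0 < c ∧ rootFunction cs D Q J j =
          c • D.action cs (w * cs.simple s) (D.basis s)) → False := by
      rintro I J K j k hg rfl hflip ⟨c, hc, heq⟩
      obtain ⟨c', hc', heq'⟩ := hflip.rootFunction_right
      have hk : k ∈ K := by simp [hflip.eq_insert]
      have h1 := hg k hk
      rw [heq', heq, smul_smul, map_neg, map_smul, D.action_inv_action, ← smul_neg,
        D.nonneg_smul_iff (by positivity)] at h1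
      exact D.basis.ne_zero s ((D.nonneg_basis s).eq_zero h1)
    intro I₁ I₂ hI₁ hI₂ hg₁ hg₂
    have h₁ := hg₁.mul_simple hI₁ (hQ.linearIndependent _ hI₁) s
    have h₂ := hg₂.mul_simple hI₂ (hQ.linearIndependent _ hI₂) s
    rw [hback] at h₁ h₂
    rcases h₁ with h₁ | ⟨J₁, i₁, j₁, hJ₁, hi₁, hf₁, h₁, hc₁⟩ <;>
      rcases h₂ with h₂ | ⟨J₂, i₂, j₂, hJ₂, hi₂, hf₂, h₂, hc₂⟩
    · exact ih hI₁ hI₂ h₁ h₂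
    · exact (mixed hg₁ (ih hJ₂ hI₁ h₂ h₁) hf₂ hc₂).elim
    · exact (mixed hg₂ (ih hJ₁ hI₂ h₁ h₂) hf₁ hc₁).elim
    · obtain rfl := ih hJ₁ hJ₂ h₁ h₂
      obtain ⟨c₁, hc₁, heq₁⟩ := hc₁
      obtain ⟨c₂, hc₂, heq₂⟩ := hc₂
      obtain ⟨d₁, hd₁, hr₁⟩ := hf₁.rootFunction_right
      obtain ⟨d₂, hd₂, hr₂⟩ := hf₂.rootFunction_right
      -- Both flips arrive at the same facet with a root on the same wall line. Independence forces
      -- the same position there, so the original facets share a ridge and have roots on the same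
      -- ray.
      have hj : j₁ = j₂ := by
        refine eq_of_rootFunction_eq_smul (hQ.linearIndependent _ hJ₁) (c := d₁ * c₁ / (d₂ * c₂))
          (by simp [hf₁.eq_insert]) (by simp [hf₂.eq_insert]) ?_
        rw [hr₁, hr₂, heq₁, heq₂, smul_neg, smul_smul, smul_smul, smul_smul, mul_assoc _ d₂,
          div_mul_cancel₀ _ (by positivity)]
      subst hj
      refine hI₁.eq_of_erase_eq_erase hI₂ hi₁ hi₂ (hf₁.erase_eq.symm.trans hf₂.erase_eq) ?_
        hc₁ hc₂ heq₁ heq₂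
      simpa using D.basis.ne_zero s

end GoodFacets

/-! ### Maximality of brick vectors and the resulting cones. -/

section Cones

variable {S : Type*} [Finite S] {M : CoxeterMatrix S} {W : Type*} [Group W]
variable {cs : CoxeterSystem M W}
variable {V : Type*} [NormedAddCommGroup V] [InnerProductSpace ℝ V] {D : SimpleRoots M V}
variable {m : ℕ} {Q : Fin m → S}

lemma SimpleRoots.Nonneg.inner_nonneg {v f : V} (hv : D.Nonneg v)
    (hf : ∀ s, 0 ≤ ⟪f, D.basis s⟫) : 0 ≤ ⟪f, v⟫ := by
  have := Fintype.ofFinite S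
  rw [← D.basis.sum_repr v, inner_sum]
  refine Finset.sum_nonneg fun s _ => ?_
  rw [real_inner_smul_right]
  exact mul_nonneg (hv s) (hf s)

lemma SimpleRoots.Nonneg.inner_pos {v f : V} (hv : D.Nonneg v) (hv0 : v ≠ 0)
    (hf : ∀ s, 0 < ⟪f, D.basis s⟫) : 0 < ⟪f, v⟫ := by
  have := Fintype.ofFinite S
  obtain ⟨s, hs⟩ : ∃ s, D.basis.repr v s ≠ 0 := by
    by_contra! h
    exact hv0 (D.basis.ext_elem fun s => by simp [h s])
  rw [← D.basis.sum_repr v, inner_sum]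
  refine Finset.sum_pos' (fun t _ => ?_) ⟨s, Finset.mem_univ s, ?_⟩
  · rw [real_inner_smul_right]
    exact mul_nonneg (hv t) (hf t).le
  · rw [real_inner_smul_right]
    exact mul_pos (lt_of_le_of_ne (hv s) hs.symm) (hf s)

variable (D) in
lemma SimpleRoots.exists_inner_basis_pos : ∃ ρ : V, ∀ s, 0 < ⟪ρ, D.basis s⟫ := by
  classical
  have := Fintype.ofFinite S
  refine ⟨∑ t, D.weight t, fun s => ?_⟩
  rw [real_inner_comm, inner_sum, Finset.sum_eq_single s]
  · exact D.inner_basis_weight_pos s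
  · intro t _ hts
    rw [D.inner_basis_weight, if_neg hts.symm]
  · simp

variable (cs D) in
/-- Every vector lies in the image of the closed dominant chamber under some group element. -/
lemma SimpleRoots.exists_dominant [Finite W] (f : V) :
    ∃ w : W, ∀ s, 0 ≤ ⟪D.action cs w⁻¹ f, D.basis s⟫ := by
  obtain ⟨ρ, hρ⟩ := D.exists_inner_basis_pos
  -- If a simple root paired negatively with this maximizing image of `f`, reflecting in it would
  -- increase the pairing with `ρ`.
  obtain ⟨w, hw⟩ := Finite.exists_max fun w : W => ⟪D.action cs w⁻¹ f, ρ⟫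
  refine ⟨w, fun s => ?_⟩
  have h := hw (w * cs.simple s)
  beta_reduce at h
  rw [mul_inv_rev, cs.inv_simple, D.action_mul_apply, D.action_simple, D.reflection_apply,
    inner_sub_left, real_inner_smul_left, real_inner_comm ρ (D.basis s)] at h
  have h1 := D.inner_basis_self_pos s
  have h2 := hρ s
  rw [real_inner_comm]
  by_contra! hneg
  have : 2 * ⟪D.basis s, D.action cs w⁻¹ f⟫ / ⟪D.basis s, D.basis s⟫ < 0 :=
    div_neg_of_neg_of_pos (by linarith) h1
  nlinarith

/-- A linear functional that is positive on the root configuration of `I` is maximal over the brick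
vectors at `I`. -/
theorem IsRealizing.inner_brickVector_le [Finite W] (hQ : IsRealizing cs D Q)
    {I J : Finset (Fin m)} (hI : IsFacet cs Q I) (hJ : IsFacet cs Q J) {f : V}
    (hf : ∀ i ∈ I, 0 < ⟪f, rootFunction cs D Q I i⟫) :
    ⟪f, brickVector cs D Q J⟫ ≤ ⟪f, brickVector cs D Q I⟫ := by
  obtain ⟨w, hw⟩ := D.exists_dominant cs f
  obtain ⟨ρ, hρ⟩ := D.exists_inner_basis_pos
  have hinner : ∀ g v : V, ⟪g, v⟫ = ⟪D.action cs w⁻¹ g, D.action cs w⁻¹ v⟫ := fun g v => by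
    rw [LinearIsometryEquiv.inner_map_map]
  have hgood : IsGood cs D Q w I := by
    intro i hi
    by_contra hc
    have h1 := (((isRoot_rootFunction I i).action w⁻¹).nonneg_neg hc).inner_nonneg hw
    rw [inner_neg_right, ← hinner] at h1
    linarith [hf i hi]
  let F : Set (Finset (Fin m)) :=
    {K | IsFacet cs Q K ∧ ⟪f, brickVector cs D Q J⟫ ≤ ⟪f, brickVector cs D Q K⟫}
  -- `f` may vanish on roots, so maximizing it alone would not force goodness. The image of `ρ` is
  -- strictly positive on the `w`-images of positive roots and breaks ties.
  obtain ⟨K, ⟨hK, hJK⟩, hmax⟩ := Set.exists_max_image F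
    (fun K => ⟪D.action cs w ρ, brickVector cs D Q K⟫) (Set.toFinite F) ⟨J, hJ, le_rfl⟩
  suffices IsGood cs D Q w K by rwa [hQ.eq_of_isGood w hI hK hgood this]
  intro k hk
  by_contra hc
  have hroot := (isRoot_rootFunction (cs := cs) (D := D) (Q := Q) K k).action w⁻¹
  have hneg := hroot.nonneg_neg hc
  obtain ⟨L, l, hL, hflip⟩ := hK.exists_flip (D := D) hk
  obtain ⟨c, hc0, heq⟩ := hflip.brickVector_eq
  have h1 := hneg.inner_nonneg hw
  have h2 := hneg.inner_pos (neg_ne_zero.mpr hroot.ne_zero) hρ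
  rw [inner_neg_right, ← hinner] at h1
  rw [inner_neg_right, ← D.inner_action_left] at h2
  have hLF : L ∈ F := by
    refine ⟨hL, hJK.trans ?_⟩
    rw [heq, inner_sub_right, real_inner_smul_right]
    nlinarith
  have h3 := hmax L hLF
  rw [heq, inner_sub_right, real_inner_smul_right] at h3
  nlinarith

/-- The coordinates of the difference in the root configuration are its pairings with the dual
basis, and maximality of `B(I)` makes these non-positive. -/
theorem IsRealizing.sub_mem_hull [Finite W] (hQ : IsRealizing cs D Q) {I J : Finset (Fin m)}
    (hI : IsFacet cs Q I) (hJ : IsFacet cs Q J) :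
    brickVector cs D Q J - brickVector cs D Q I ∈
      PointedCone.hull ℝ {y | ∃ i, y = -rootConfiguration cs D Q I i} := by
  classical
  let b := Module.Basis.mk (hQ.linearIndependent I hI) (hQ.span_eq_top I hI).ge
  have hb : ∀ i, b i = rootConfiguration cs D Q I i := fun i => Module.Basis.mk_apply _ _ i
  let d := LinearMap.BilinForm.dualBasis (innerₗ V) (inner_nondegenerate V) b
  have hd : ∀ i j, ⟪d i, b j⟫ = if j = i then (1 : ℝ) else 0 := fun i j =>
    LinearMap.BilinForm.apply_dualBasis_left (inner_nondegenerate V) b i j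
  set x := brickVector cs D Q J - brickVector cs D Q I with hx
  have hrepr : ∀ i, b.repr x i = ⟪d i, x⟫ := by
    intro i
    conv_rhs => rw [← b.sum_repr x]
    simp [inner_sum, real_inner_smul_right, hd]
  have hle : ∀ i, b.repr x i ≤ 0 := by
    intro i
    rw [hrepr]
    -- A dual basis vector vanishes on the other roots; adding `ε` times the sum of all of them
    -- makes it strictly positive on the configuration.
    have hε : ∀ ε : ℝ, 0 < ε → ⟪d i, x⟫ ≤ ε * -⟪∑ j, d j, x⟫ := by
      intro ε hε
      have h1 : ⟪d i + ε • ∑ j, d j, x⟫ ≤ 0 := by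
        rw [hx, inner_sub_right, sub_nonpos]
        refine hQ.inner_brickVector_le hI hJ fun k hk => ?_
        have h2 := hb ⟨k, hk⟩
        rw [rootConfiguration] at h2
        rw [← h2, inner_add_left, real_inner_smul_left, sum_inner, hd]
        simp only [hd, Finset.sum_ite_eq, Finset.mem_univ, if_true]
        split_ifs <;> linarith
      rw [inner_add_left, real_inner_smul_left] at h1
      linarith
    by_contra! hpos
    set a := ⟪d i, x⟫
    set e := -⟪∑ j, d j, x⟫
    -- This `ε` bounds the error term by `a / 2`, contradicting `0 < a`.
    have h1 := hε (a / (2 * (|e| + 1))) (by positivity)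
    have h2 : a / (2 * (|e| + 1)) * e ≤ a / (2 * (|e| + 1)) * (|e| + 1) := by
      gcongr
      linarith [le_abs_self e]
    have h3 : a / (2 * (|e| + 1)) * (|e| + 1) = a / 2 := by
      have : |e| + 1 ≠ 0 := by positivity
      field_simp
    linarith
  rw [← b.sum_repr x]
  refine Submodule.sum_mem _ fun i _ => ?_
  have h1 : b.repr x i • b i = (⟨-b.repr x i, neg_nonneg.mpr (hle i)⟩ : {c : ℝ // 0 ≤ c}) •
      (-rootConfiguration cs D Q I i) := by
    rw [← hb, Nonneg.mk_smul, smul_neg, neg_smul, neg_neg]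
  rw [h1]
  exact Submodule.smul_mem _ _ (Submodule.subset_span ⟨i, rfl⟩)

/-- The flip at `i` moves the brick vector by a negative multiple of this root; rescale. -/
lemma IsFacet.neg_rootConfiguration_mem_hull [Finite W] {I : Finset (Fin m)}
    (hI : IsFacet cs Q I) (i : I) : -rootConfiguration cs D Q I i ∈
      PointedCone.hull ℝ {y | ∃ J, IsFacet cs Q J ∧
        y = brickVector cs D Q J - brickVector cs D Q I} := by
  obtain ⟨J, j, hJ, hflip⟩ := hI.exists_flip (D := D) i.2
  obtain ⟨c, hc, heq⟩ := hflip.brickVector_eq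
  have h1 : -rootConfiguration cs D Q I i = (⟨c⁻¹, inv_nonneg.mpr hc.le⟩ : {c : ℝ // 0 ≤ c}) •
      (brickVector cs D Q J - brickVector cs D Q I) := by
    rw [heq, Nonneg.mk_smul, sub_sub_cancel_left, smul_neg, inv_smul_smul₀ hc.ne']
    rfl
  rw [h1]
  exact Submodule.smul_mem _ _ (Submodule.subset_span ⟨J, hJ, rfl⟩)

/-- The cone of a convex hull at a point is generated by the differences with the given points. -/
lemma coneAt_convexHull {E : Type*} [AddCommGroup E] [Module ℝ E] (X : Set E) (v : E) :
    coneAt (convexHull ℝ X) v = PointedCone.hull ℝ {y | ∃ x ∈ X, y = x - v} := by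
  apply le_antisymm
  · refine Submodule.span_le.mpr ?_
    rintro _ ⟨x, hx, rfl⟩
    set C := PointedCone.hull ℝ {y | ∃ x ∈ X, y = x - v}
    have hconv : Convex ℝ ((fun x => x + -v) ⁻¹' (C : Set E)) :=
      (C : ConvexCone ℝ E).convex.translate_preimage_left (-v)
    have h1 : X ⊆ (fun x => x + -v) ⁻¹' (C : Set E) := fun x hx =>
      Submodule.subset_span ⟨x, hx, (sub_eq_add_neg x v).symm⟩
    have := convexHull_min h1 hconv hx
    rwa [sub_eq_add_neg]
  · refine Submodule.span_mono ?_
    rintro _ ⟨x, hx, rfl⟩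
    exact ⟨x, subset_convexHull ℝ X hx, rfl⟩

end Cones

end BrickPolytope

end

theorem mainTheorem2 {S : Type*} [Finite S] {M : CoxeterMatrix S}
    {W : Type*} [Group W] [Finite W] (cs : CoxeterSystem M W)
    {V : Type*} [NormedAddCommGroup V] [InnerProductSpace ℝ V]
    (D : BrickPolytope.SimpleRoots M V)
    {m : ℕ} (Q : Fin m → S) (hQ : BrickPolytope.IsRealizing cs D Q)
    (I : Finset (Fin m)) (hI : BrickPolytope.IsFacet cs Q I) :
    BrickPolytope.coneAt (BrickPolytope.brickPolytope cs D Q)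
        (BrickPolytope.brickVector cs D Q I) =
      PointedCone.hull ℝ {y | ∃ J, BrickPolytope.IsFacet cs Q J ∧
        y = BrickPolytope.brickVector cs D Q J - BrickPolytope.brickVector cs D Q I} ∧
    PointedCone.hull ℝ {y | ∃ J, BrickPolytope.IsFacet cs Q J ∧
        y = BrickPolytope.brickVector cs D Q J - BrickPolytope.brickVector cs D Q I} =
      PointedCone.hull ℝ {y | ∃ i, y = -BrickPolytope.rootConfiguration cs D Q I i} := by
  refine ⟨?_, le_antisymm (Submodule.span_le.mpr ?_) (Submodule.span_le.mpr ?_)⟩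
  · rw [BrickPolytope.brickPolytope, BrickPolytope.coneAt_convexHull]
    congr 1
    ext y
    constructor
    · rintro ⟨_, ⟨J, hJ, rfl⟩, rfl⟩
      exact ⟨J, hJ, rfl⟩
    · rintro ⟨J, hJ, rfl⟩
      exact ⟨_, ⟨J, hJ, rfl⟩, rfl⟩
  · rintro _ ⟨J, hJ, rfl⟩
    exact hQ.sub_mem_hull hI hJ
  · rintro _ ⟨i, rfl⟩
    exact hI.neg_rootConfiguration_mem_hull i
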